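/- Let $n,m\ge 1$ be integers and let $\mathbb H=\{(x,t): x\in\mathbb R^n,\ t>0\}\subset\mathbb R^{n+1}$; write $z=(x,t)$ and $w=(y,s)$ for points of $\mathbb H$, and $dz$, $dw$ for Lebesgue measure. Let $\{\Delta_k\}_{k\ge1}$ be a Whitney decomposition of $\mathbb H$: closed cubes with sides parallel to the coordinate axes, with pairwise disjoint interiors and union $\mathbb H$, such that $\operatorname{diam}\Delta_k\asymp\operatorname{dist}(\Delta_k,\partial\mathbb H)$ uniformly in $k$, and such that the concentric cubes enlarged $5/4$ times have uniformly bounded overlap on $\mathbb H$. Let $\eta_k$ be the last coordinate of the center of $\Delta_k$. For $w=(y,s)\in\mathbb H$ let $Q_w$ be the cube with sides parallel to the coordinate axes, center $w$ and side length $s$. Let $0<p,q<\infty$, and let $0<\sigma_i\le q$ and $-1<\alpha_i<\infty$ for $i=1,\dots,m$. Let $\mu$ be a positive Borel measure on $\mathbb H$. For harmonic functions $f_1,\dots,f_m$ on $\mathbb H$ put $$\|(f_1,\dots,f_m)\|_{A(p,q,m,d\mu)}^q=\sum_{k=1}^\infty\Big(\int_{\Delta_k}\prod_{i=1}^m|f_i(z)|^p\,d\mu(z)\Big)^{q/p}.$$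 Then the following two conditions are equivalent. 1. There is a constant $C<\infty$ such that for every $m$-tuple $(f_1,\dots,f_m)$ of harmonic functions on $\mathbb H$ $$\|(f_1,\dots,f_m)\|_{A(p,q,m,d\mu)}^q\le C\prod_{i=1}^m\int_{\mathbb H}\Big(\int_{Q_w}|f_i(z)|^{\sigma_i}t^{\alpha_i}\,dz\Big)^{q/\sigma_i}dw,$$ where both sides may be infinite and $0\cdot\infty=0$. 2. There is a constant $C<\infty$ such that $$\mu(\Delta_k)\le C\,\eta_k^{\,m(n+1)\frac pq+\sum_{i=1}^m\frac{p(n+1+\alpha_i)}{\sigma_i}},\qquad k\ge1.$$ -/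

import Mathlib

open MeasureTheory Set
open scoped ENNReal NNReal

/-- The Euclidean space `ℝ^{n+1}`, whose points are `z = (x, t)`; `t` is the last coordinate. -/
abbrev AmbientSpace (n : ℕ) : Type := EuclideanSpace ℝ (Fin (n + 1))

/-- The height `t` of a point `z = (x, t)`. -/
def height {n : ℕ} (z : AmbientSpace n) : ℝ := z (Fin.last n)

/-- The open upper half space `{(x, t) : t > 0}`. -/
def upperHalf (n : ℕ) : Set (AmbientSpace n) := {z | 0 < height z}

/-- The closed cube with sides parallel to the coordinate axes, with center `c` and side `ℓ`. -/
def axisCube {n : ℕ} (c : AmbientSpace n) (ℓ : ℝ) : Set (AmbientSpace n) :=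
  {z | ∀ i, |z i - c i| ≤ ℓ / 2}

/-- The distance `inf {|a - b| : a ∈ A, b ∈ B}` between two (nonempty) sets. -/
noncomputable def setDist {n : ℕ} (A B : Set (AmbientSpace n)) : ℝ :=
  sInf (Set.image2 dist A B)

/-- The closed cubes `Δ_k`, with centers `ζ k` and sides `ℓ k`, form a Whitney decomposition of the
upper half space: they cover it, their diameters are comparable to their distances from the
boundary, their interiors are pairwise disjoint, and the concentric cubes enlarged `5/4` times
overlap finitely. -/
structure IsWhitneyDecomposition {n : ℕ} (ζ : ℕ → AmbientSpace n) (ℓ : ℕ → ℝ) : Prop where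
  side_pos : ∀ k, 0 < ℓ k
  iUnion_eq : ⋃ k, axisCube (ζ k) (ℓ k) = upperHalf n
  diam_comparable : ∃ c C : ℝ, 0 < c ∧ 0 < C ∧ ∀ k,
    c * setDist (axisCube (ζ k) (ℓ k)) (frontier (upperHalf n))
        ≤ Metric.diam (axisCube (ζ k) (ℓ k)) ∧
    Metric.diam (axisCube (ζ k) (ℓ k))
        ≤ C * setDist (axisCube (ζ k) (ℓ k)) (frontier (upperHalf n))
  interior_disjoint : ∀ j k, j ≠ k →
    Disjoint (interior (axisCube (ζ j) (ℓ j))) (interior (axisCube (ζ k) (ℓ k)))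
  finite_overlap : ∃ N : ℕ, ∀ z ∈ upperHalf n,
    {k | z ∈ axisCube (ζ k) (5 / 4 * ℓ k)}.encard ≤ N

/-- The `q`-th power `‖(f_1, …, f_m)‖_{A(p,q,m,dμ)}^q = ∑_k (∫_{Δ_k} ∏_i |f_i|^p dμ)^{q/p}`,
where `Δ_k` is the closed cube with center `ζ k` and side `ℓ k`. -/
noncomputable def multiNormPow {n m : ℕ} (ζ : ℕ → AmbientSpace n) (ℓ : ℕ → ℝ) (p q : ℝ)
    (μ : Measure (AmbientSpace n)) (f : Fin m → AmbientSpace n → ℝ) : ℝ≥0∞ :=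
  ∑' k, (∫⁻ z in axisCube (ζ k) (ℓ k), ∏ i, ‖f i z‖ₑ ^ p ∂μ) ^ (q / p)

/-- The cube `Q_w` with center `w = (y, s)` and side `s`. -/
def heightCube {n : ℕ} (w : AmbientSpace n) : Set (AmbientSpace n) :=
  axisCube w (height w)

/-- The quantity `∫_ℍ (∫_{Q_w} |f(z)|^σ t^α dz)^{q/σ} dw`. -/
noncomputable def cubeAverageNormPow {n : ℕ} (q σ α : ℝ) (f : AmbientSpace n → ℝ) : ℝ≥0∞ :=
  ∫⁻ w in upperHalf n,
    (∫⁻ z in heightCube w, ‖f z‖ₑ ^ σ * ENNReal.ofReal (height z ^ α)) ^ (q / σ)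

/-! Write η for the height of the center of a Whitney cube Δ; its side and its distance from the
boundary are comparable to η (`exists_comparable`).

Measure bound ⇒ norm inequality. For every σ > 0 the power |f|^σ of a harmonic function has the
sub-mean-value property (`exists_enorm_rpow_le_setLIntegral_ball`). If z ∈ Δ and w is within a small
multiple of η of z, a ball about z of radius comparable to η lies in Q_w, so the inner integral over
Q_w dominates |f(z)|^σ η^(n+1+α). Raising to the power q/σ and integrating over such w, a ball of
volume ≍ η^(n+1), bounds |f(z)|^q η^(n+1+(n+1+α)q/σ). These balls lie in the cubes enlarged 5/4
times, so bounded overlap allows summation over all cubes, with z the maximum point of |f_i| in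
each. The exponent in the bound on μ(Δ), multiplied by q/p, is the sum over i of these weights, and
a sum of products of nonnegative terms is at most the product of the sums.

Norm inequality ⇒ measure bound. The test functions are Kelvin transforms of powers of an isotropic
linear form, with pole at depth comparable to η below the half space. After normalization such a
function is bounded below on Δ and decays like (η/|z-a|)^M, where M can be taken as large as needed.
For large M its mixed norm is O(η^(n+1+(n+1+α)q/σ)) by scaling. Putting one such function in all m
slots and keeping only the term of Δ bounds μ(Δ). -/

/-! ### Translation and scaling of Haar integrals -/

theorem lintegral_eq_mul_lintegral_add_smul {E : Type*} [NormedAddCommGroup E] [NormedSpace ℝ E]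
    [FiniteDimensional ℝ E] [MeasurableSpace E] [BorelSpace E] (ν : Measure E) [ν.IsAddHaarMeasure]
    (g : E → ℝ≥0∞) (z : E) {r : ℝ} (hr : 0 < r) :
    ∫⁻ w, g w ∂ν = ENNReal.ofReal (r ^ Module.finrank ℝ E) * ∫⁻ y, g (z + r • y) ∂ν := by
  let m : E ≃ᵐ E := (Homeomorph.smulOfNeZero r hr.ne').toMeasurableEquiv
  have h1 := lintegral_map_equiv (μ := ν) (fun y => g (z + y)) m
  have h2 : Measure.map m ν = ENNReal.ofReal (r ^ Module.finrank ℝ E)⁻¹ • ν := by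
    have := Measure.map_addHaar_smul ν hr.ne'
    rw [show (m : E → E) = (r • ·) from rfl, this, abs_of_pos (by positivity)]
  rw [h2, lintegral_smul_measure, smul_eq_mul, lintegral_add_left_eq_self] at h1
  change _ = ∫⁻ y, g (z + r • y) ∂ν at h1
  rw [← h1, ← mul_assoc, ← ENNReal.ofReal_mul (by positivity), mul_inv_cancel₀ (by positivity),
    ENNReal.ofReal_one, one_mul]

theorem setLIntegral_ball_eq {E : Type*} [NormedAddCommGroup E] [NormedSpace ℝ E]
    [FiniteDimensional ℝ E] [MeasurableSpace E] [BorelSpace E] (ν : Measure E) [ν.IsAddHaarMeasure]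
    (g : E → ℝ≥0∞) (z : E) {r : ℝ} (hr : 0 < r) (ρ : ℝ) :
    ∫⁻ w in Metric.ball z (r * ρ), g w ∂ν =
      ENNReal.ofReal (r ^ Module.finrank ℝ E) * ∫⁻ y in Metric.ball 0 ρ, g (z + r • y) ∂ν := by
  rw [← lintegral_indicator Metric.isOpen_ball.measurableSet,
    ← lintegral_indicator Metric.isOpen_ball.measurableSet,
    lintegral_eq_mul_lintegral_add_smul ν _ z hr]
  congr 2 with y
  have : z + r • y ∈ Metric.ball z (r * ρ) ↔ y ∈ Metric.ball (0 : E) ρ := by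
    rw [mem_ball_zero_iff, mem_ball_iff_norm, add_sub_cancel_left, norm_smul,
      Real.norm_of_nonneg hr.le, mul_lt_mul_iff_right₀ hr]
  by_cases h : y ∈ Metric.ball (0 : E) ρ
  · rw [indicator_of_mem h, indicator_of_mem (this.2 h)]
  · rw [indicator_of_notMem h, indicator_of_notMem (fun h' => h (this.1 h'))]

/-! ### The radial bump and its potential -/

/-- The bump `max (1 - |y|²) 0`. -/
noncomputable def paraboloidBump {E : Type*} [NormedAddCommGroup E] (y : E) : ℝ :=
  max (1 - ‖y‖ ^ 2) 0

section Bump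
variable {E : Type*} [NormedAddCommGroup E]

theorem continuous_paraboloidBump : Continuous (paraboloidBump : E → ℝ) := by
  unfold paraboloidBump; fun_prop

theorem paraboloidBump_nonneg (y : E) : 0 ≤ paraboloidBump y := le_max_right _ _

theorem paraboloidBump_le_one (y : E) : paraboloidBump y ≤ 1 :=
  max_le (by nlinarith [norm_nonneg y]) zero_le_one

theorem paraboloidBump_eq_zero {y : E} (hy : 1 ≤ ‖y‖) : paraboloidBump y = 0 :=
  max_eq_right (by nlinarith)

/-- With φ the bump, the radial field φ(y)y is thus minus the gradient of the C¹ function φ²/4,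
which vanishes outside the unit ball. This makes integration by parts against the bump possible
without surface integrals. -/
theorem hasFDerivAt_paraboloidBump_sq [InnerProductSpace ℝ E] (y : E) :
    HasFDerivAt (fun y : E => paraboloidBump y ^ 2 / 4)
      (-(paraboloidBump y) • innerSL ℝ y) y := by
  have key : ∀ s : ℝ, HasDerivAt (fun s : ℝ => (max s 0) ^ 2) (2 * max s 0) s := by
    intro s
    rcases lt_trichotomy s 0 with h | h | h
    · rw [max_eq_right h.le, mul_zero]
      refine (hasDerivAt_const s (0 : ℝ)).congr_of_eventuallyEq ?_
      filter_upwards [gt_mem_nhds h] with x hx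
      simp [max_eq_right hx.le]
    · subst h
      rw [max_self, mul_zero, hasDerivAt_iff_isLittleO]
      simp only [max_self, sub_zero, smul_zero, ne_eq, OfNat.ofNat_ne_zero, not_false_eq_true,
        zero_pow]
      refine Asymptotics.IsBigO.trans_isLittleO (g := fun x : ℝ => x ^ 2) ?_ ?_
      · refine Asymptotics.IsBigO.of_bound 1 (Filter.Eventually.of_forall fun x => ?_)
        rw [one_mul, norm_pow, norm_pow]
        gcongr
        rw [Real.norm_eq_abs, Real.norm_eq_abs, abs_of_nonneg (le_max_right _ _)]
        exact max_le (le_abs_self _) (abs_nonneg _)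
      · exact Asymptotics.isLittleO_pow_id one_lt_two
    · rw [max_eq_left h.le]
      refine HasDerivAt.congr_of_eventuallyEq (f := fun x : ℝ => x ^ 2)
        (by simpa using hasDerivAt_pow 2 s) ?_
      filter_upwards [lt_mem_nhds h] with x hx
      simp [max_eq_left hx.le]
  have h1 : HasFDerivAt (fun y : E => 1 - ‖y‖ ^ 2) (-(2 • innerSL ℝ y)) y :=
    (hasStrictFDerivAt_norm_sq y).hasFDerivAt.const_sub 1
  have h2 := ((key (1 - ‖y‖ ^ 2)).comp_hasFDerivAt y h1).const_mul (1 / 4)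
  refine (h2.congr_fderiv ?_).congr_of_eventuallyEq (Filter.Eventually.of_forall fun x => ?_)
  · ext v
    simp [paraboloidBump]
    ring
  · simp [paraboloidBump]; ring

end Bump

/-! ### Mean value property of harmonic functions -/

section MeanValue
open InnerProductSpace Laplacian Topology
variable {E : Type*} [NormedAddCommGroup E] [InnerProductSpace ℝ E] [FiniteDimensional ℝ E]
  [MeasurableSpace E] [BorelSpace E] (ν : Measure E) [ν.IsAddHaarMeasure]

theorem integrable_mul_of_continuousOn_closedBall {ψ h : E → ℝ} (hψ : Continuous ψ)
    (hψ0 : ∀ y, 1 < ‖y‖ → ψ y = 0) (hh : ContinuousOn h (Metric.closedBall 0 1)) :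
    Integrable (fun y => ψ y * h y) ν := by
  have : IntegrableOn (fun y => ψ y * h y) (Metric.closedBall 0 1) ν :=
    (hψ.continuousOn.mul hh).integrableOn_compact (isCompact_closedBall 0 1)
  rwa [integrableOn_iff_integrable_of_support_subset] at this
  intro y hy
  by_contra hc
  rw [mem_closedBall_zero_iff, not_le] at hc
  exact hy (by simp [hψ0 y hc])

/-- With Φ = φ²/4, integration by parts along an orthonormal basis turns the integral of
φ(y)∇u(z+ry)·y = -∇Φ(y)·∇u(z+ry) into r times that of Φ(y)Δu(z+ry), which is zero. -/
theorem integral_paraboloidBump_mul_fderiv_eq_zero {u : E → ℝ} {z : E} {r : ℝ}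
    (hu : ∀ y ∈ Metric.closedBall (0 : E) 1, HarmonicAt u (z + r • y)) :
    ∫ y, paraboloidBump y * fderiv ℝ u (z + r • y) y ∂ν = 0 := by
  set b := stdOrthonormalBasis ℝ E
  set Φ : E → ℝ := fun y => paraboloidBump y ^ 2 / 4 with hΦ
  have hΦc : Continuous Φ := (continuous_paraboloidBump.pow 2).div_const 4
  have hΦ0 : ∀ y, 1 < ‖y‖ → Φ y = 0 := fun y hy => by
    simp [hΦ, paraboloidBump_eq_zero hy.le]
  have hsupp : tsupport Φ ⊆ Metric.closedBall 0 1 := by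
    refine closure_minimal (fun y hy => ?_) Metric.isClosed_closedBall
    by_contra h
    rw [mem_closedBall_zero_iff, not_le] at h
    exact hy (hΦ0 y h)
  have hDu : ∀ y ∈ Metric.closedBall (0 : E) 1, ContDiffAt ℝ 1 (fderiv ℝ u) (z + r • y) :=
    fun y hy => (hu y hy).1.fderiv_right (by norm_num)
  have haff : ∀ y : E, HasFDerivAt (fun y : E => z + r • y) (r • ContinuousLinearMap.id ℝ E) y :=
    fun y => ((hasFDerivAt_id y).const_smul r).const_add z
  have hg : ∀ i, ∀ y ∈ Metric.closedBall (0 : E) 1,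
      ContDiffAt ℝ 1 (fun y => fderiv ℝ u (z + r • y) (b i)) y := fun i y hy =>
    ((hDu y hy).comp y (f := fun y : E => z + r • y) (by fun_prop)).clm_apply contDiffAt_const
  have hg' : ∀ i, ∀ y ∈ Metric.closedBall (0 : E) 1,
      fderiv ℝ (fun y => fderiv ℝ u (z + r • y) (b i)) y (b i) =
        r * iteratedFDeriv ℝ 2 u (z + r • y) ![b i, b i] := by
    intro i y hy
    have h1 : HasFDerivAt (fun y => fderiv ℝ u (z + r • y)) _ y :=
      ((hDu y hy).differentiableAt (by norm_num)).hasFDerivAt.comp y (haff y)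
    have h2 := h1.clm_apply (hasFDerivAt_const (b i) y)
    rw [h2.fderiv, iteratedFDeriv_two_apply]
    simp
  have hcont : ∀ i, ContinuousOn (fun y => fderiv ℝ u (z + r • y) (b i))
      (Metric.closedBall 0 1) := fun i y hy => (hg i y hy).continuousAt.continuousWithinAt
  have hcont' : ∀ i, ContinuousOn
      (fun y => fderiv ℝ (fun y => fderiv ℝ u (z + r • y) (b i)) y (b i))
      (Metric.closedBall 0 1) := fun i y hy =>
    (((hg i y hy).fderiv_right (m := 0) (by norm_num)).continuousAt.clm_apply
      continuousAt_const).continuousWithinAt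
  have hΦd : ∀ y (v : E), fderiv ℝ Φ y v = -(paraboloidBump y * inner ℝ y v) := fun y v => by
    rw [(hasFDerivAt_paraboloidBump_sq y).fderiv]; simp
  have hint : ∀ i, Integrable (fun y => fderiv ℝ Φ y (b i) * fderiv ℝ u (z + r • y) (b i)) ν := by
    intro i
    refine integrable_mul_of_continuousOn_closedBall ν ?_ ?_ (hcont i)
    · simp only [hΦd]
      exact (continuous_paraboloidBump.mul (by fun_prop)).neg
    · intro y hy
      simp [hΦd, paraboloidBump_eq_zero hy.le]
  have hint' : ∀ i, Integrable
      (fun y => Φ y * fderiv ℝ (fun y => fderiv ℝ u (z + r • y) (b i)) y (b i)) ν := fun i =>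
    integrable_mul_of_continuousOn_closedBall ν hΦc hΦ0 (hcont' i)
  have parts : ∀ i, ∫ y, Φ y * fderiv ℝ (fun y => fderiv ℝ u (z + r • y) (b i)) y (b i) ∂ν =
      - ∫ y, fderiv ℝ Φ y (b i) * fderiv ℝ u (z + r • y) (b i) ∂ν := fun i =>
    integral_mul_fderiv_eq_neg_fderiv_mul_of_integrable (hint i) (hint' i)
      (integrable_mul_of_continuousOn_closedBall ν hΦc hΦ0 (hcont i))
      (fun y _ => (hasFDerivAt_paraboloidBump_sq y).differentiableAt)
      (fun y hy => (hg i y (hsupp hy)).differentiableAt (by norm_num))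
  have sum1 : ∑ i, ∫ y, Φ y * fderiv ℝ (fun y => fderiv ℝ u (z + r • y) (b i)) y (b i) ∂ν = 0 := by
    rw [← integral_finsetSum _ fun i _ => hint' i]
    refine (integral_congr_ae (Filter.Eventually.of_forall fun y => ?_)).trans (integral_zero _ _)
    by_cases hy : y ∈ Metric.closedBall (0 : E) 1
    · have hl : Δ u (z + r • y) = 0 := (hu y hy).2.self_of_nhds
      rw [laplacian_eq_iteratedFDeriv_orthonormalBasis u b] at hl
      simp only [hg' _ y hy, ← Finset.mul_sum, hl, mul_zero]
    · rw [mem_closedBall_zero_iff, not_le] at hy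
      simp [hΦ0 y hy]
  simp only [parts, Finset.sum_neg_distrib, neg_eq_zero] at sum1
  rw [← integral_finsetSum _ fun i _ => hint i] at sum1
  rw [← neg_eq_zero, ← integral_neg, ← sum1]
  refine integral_congr_ae (Filter.Eventually.of_forall fun y => ?_)
  simp only [hΦd, neg_mul, Finset.sum_neg_distrib, mul_assoc, ← Finset.mul_sum, neg_inj]
  congr 1
  have hy := congrArg (fderiv ℝ u (z + r • y)) (b.sum_repr' y)
  rw [← hy, map_sum]
  simp [real_inner_comm]

/-- The derivative in r of the left side is the integral that was just shown to vanish. The left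
side is therefore constant on (-R, R) and equals its value at r = 0. -/
theorem integral_paraboloidBump_mul_eq {u : E → ℝ} {z : E} {R : ℝ}
    (hu : HarmonicOnNhd u (Metric.ball z R)) {r : ℝ} (hr : |r| < R) :
    ∫ y, paraboloidBump y * u (z + r • y) ∂ν = u z * ∫ y : E, paraboloidBump y ∂ν := by
  have hmem : ∀ r : ℝ, |r| < R → ∀ y ∈ Metric.closedBall (0 : E) 1, z + r • y ∈ Metric.ball z R := by
    intro r hr y hy
    rw [mem_closedBall_zero_iff] at hy
    rw [mem_ball_iff_norm, add_sub_cancel_left, norm_smul, Real.norm_eq_abs]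
    nlinarith [abs_nonneg r, norm_nonneg y]
  have hu' : ∀ r : ℝ, |r| < R → ∀ y ∈ Metric.closedBall (0 : E) 1, HarmonicAt u (z + r • y) :=
    fun r hr y hy => hu _ (hmem r hr y hy)
  have hD : ∀ r ∈ Ioo (-R) R,
      HasDerivAt (fun r => ∫ y, paraboloidBump y * u (z + r • y) ∂ν) 0 r := by
    intro r hr
    obtain ⟨ρ, hρ, hρR⟩ := exists_between (abs_lt.2 ⟨hr.1, hr.2⟩)
    have hρ0 : 0 ≤ ρ := (abs_nonneg r).trans hρ.le
    have hbsub : Metric.closedBall z ρ ⊆ Metric.ball z R := Metric.closedBall_subset_ball hρR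
    have hcD : ContinuousOn (fderiv ℝ u) (Metric.closedBall z ρ) := fun x hx =>
      (((hu x (hbsub hx)).1.fderiv_right (m := 1) (by norm_num)).continuousAt).continuousWithinAt
    obtain ⟨M, hM⟩ := (isCompact_closedBall z ρ).exists_bound_of_continuousOn hcD
    have hcomp : ∀ r : ℝ, |r| < R →
        ContinuousOn (fun y => u (z + r • y)) (Metric.closedBall 0 1) := fun r hr y hy =>
      ((hu' r hr y hy).1.continuousAt.comp (f := fun y : E => z + r • y)
        (by fun_prop)).continuousWithinAt
    have h0 : ∀ y : E, 1 < ‖y‖ → paraboloidBump y = 0 := fun y hy => paraboloidBump_eq_zero hy.le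
    have hs : Ioo (-ρ) ρ ∈ 𝓝 r := Ioo_mem_nhds (neg_lt_of_abs_lt hρ) (lt_of_abs_lt hρ)
    have key := hasDerivAt_integral_of_dominated_loc_of_deriv_le (μ := ν) (𝕜 := ℝ) (x₀ := r)
      (s := Ioo (-ρ) ρ)
      (F := fun r y => paraboloidBump y * u (z + r • y))
      (F' := fun r y => paraboloidBump y * fderiv ℝ u (z + r • y) y)
      (bound := fun y => paraboloidBump y * M) hs
      (by
        filter_upwards [hs] with s hs
        exact (integrable_mul_of_continuousOn_closedBall ν continuous_paraboloidBump h0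
          (hcomp s ((abs_lt.2 hs).trans hρR))).aestronglyMeasurable)
      (integrable_mul_of_continuousOn_closedBall ν continuous_paraboloidBump h0
        (hcomp r (hρ.trans hρR)))
      (by
        refine (integrable_mul_of_continuousOn_closedBall ν continuous_paraboloidBump h0
          (fun y hy => ?_)).aestronglyMeasurable
        have h1 : ContinuousAt (fderiv ℝ u) (z + r • y) :=
          ((hu' r (hρ.trans hρR) y hy).1.fderiv_right (m := 1) (by norm_num)).continuousAt
        exact ((h1.comp (f := fun y : E => z + r • y) (by fun_prop)).clm_apply
          continuousAt_id).continuousWithinAt)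
      (by
        refine Filter.Eventually.of_forall fun y s hs => ?_
        by_cases hy : ‖y‖ ≤ 1
        · rw [norm_mul, Real.norm_of_nonneg (paraboloidBump_nonneg y)]
          refine mul_le_mul_of_nonneg_left ?_ (paraboloidBump_nonneg y)
          have hz : z + s • y ∈ Metric.closedBall z ρ := by
            rw [mem_closedBall_iff_norm, add_sub_cancel_left, norm_smul, Real.norm_eq_abs]
            nlinarith [abs_nonneg s, norm_nonneg y, (abs_lt.2 hs)]
          have h1 := hM _ hz
          have h2 := (fderiv ℝ u (z + s • y)).le_opNorm y
          nlinarith [norm_nonneg (fderiv ℝ u (z + s • y)), norm_nonneg y]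
        · simp [h0 y (not_le.1 hy)])
      (integrable_mul_of_continuousOn_closedBall ν continuous_paraboloidBump h0
        continuousOn_const)
      (by
        refine Filter.Eventually.of_forall fun y s hs => ?_
        by_cases hy : ‖y‖ ≤ 1
        · refine HasDerivAt.const_mul _ ?_
          have h1 := (hu' s ((abs_lt.2 hs).trans hρR) y
            (by simpa using hy)).1.differentiableAt (by norm_num)
          have h2 : HasDerivAt (fun s : ℝ => z + s • y) y s := by
            simpa using ((hasDerivAt_id s).smul_const y).const_add z
          exact h1.hasFDerivAt.comp_hasDerivAt s h2
        · simp only [h0 y (not_le.1 hy), zero_mul]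
          exact hasDerivAt_const _ _)
    rw [integral_paraboloidBump_mul_fderiv_eq_zero ν (hu' r (hρ.trans hρR))] at key
    exact key.2
  have h0 : (0 : ℝ) ∈ Ioo (-R) R := by
    have := (abs_nonneg r).trans_lt hr
    constructor <;> linarith
  have := (convex_Ioo (-R) R).is_const_of_fderivWithin_eq_zero (𝕜 := ℝ)
    (f := fun r => ∫ y, paraboloidBump y * u (z + r • y) ∂ν)
    (fun x hx => (hD x hx).differentiableAt.differentiableWithinAt)
    (fun x hx => by
      rw [fderivWithin_of_isOpen isOpen_Ioo hx]
      ext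
      simp [(hD x hx).deriv]) (abs_lt.1 hr) h0
  rw [this]
  simp only [zero_smul, add_zero]
  rw [integral_mul_const, mul_comm]

theorem integral_paraboloidBump_pos : 0 < ∫ y : E, paraboloidBump y ∂ν := by
  have hint : Integrable (paraboloidBump : E → ℝ) ν := by
    simpa using integrable_mul_of_continuousOn_closedBall ν continuous_paraboloidBump
      (fun y hy => paraboloidBump_eq_zero (E := E) hy.le) (h := fun _ => 1) continuousOn_const
  rw [integral_pos_iff_support_of_nonneg paraboloidBump_nonneg hint]
  refine (Metric.measure_ball_pos ν (0 : E) one_pos).trans_le (measure_mono fun y hy => ?_)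
  rw [mem_ball_zero_iff] at hy
  have : 0 < 1 - ‖y‖ ^ 2 := by nlinarith [norm_nonneg y]
  exact (lt_max_of_lt_left this).ne'

/-- Harmonic functions satisfy a sub-mean-value inequality over balls. -/
theorem exists_enorm_le_setLIntegral_ball :
    ∃ C : ℝ≥0, ∀ (u : E → ℝ) (z : E) (R r : ℝ), HarmonicOnNhd u (Metric.ball z R) → 0 < r → r < R →
      ENNReal.ofReal (r ^ Module.finrank ℝ E) * ‖u z‖ₑ ≤ C * ∫⁻ w in Metric.ball z r, ‖u w‖ₑ ∂ν := by
  set J := ∫ y : E, paraboloidBump y ∂ν with hJ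
  have hJ0 : 0 < J := integral_paraboloidBump_pos ν
  refine ⟨Real.toNNReal J⁻¹, fun u z R r hu hr hrR => ?_⟩
  have h1 := integral_paraboloidBump_mul_eq ν hu (r := r) (by rwa [abs_of_pos hr])
  have h2 : ‖u z‖ₑ * ENNReal.ofReal J ≤ ∫⁻ y in Metric.ball 0 1, ‖u (z + r • y)‖ₑ ∂ν := by
    have : ‖u z * J‖ₑ = ‖u z‖ₑ * ENNReal.ofReal J := by
      rw [enorm_mul, Real.enorm_of_nonneg hJ0.le]
    rw [← this, ← h1, ← lintegral_indicator Metric.isOpen_ball.measurableSet]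
    refine (enorm_integral_le_lintegral_enorm _).trans (lintegral_mono fun y => ?_)
    by_cases hy : y ∈ Metric.ball (0 : E) 1
    · rw [indicator_of_mem hy, enorm_mul]
      refine mul_le_of_le_one_left zero_le ?_
      rw [Real.enorm_of_nonneg (paraboloidBump_nonneg y)]
      exact ENNReal.ofReal_le_one.2 (paraboloidBump_le_one y)
    · rw [mem_ball_zero_iff, not_lt] at hy
      simp [paraboloidBump_eq_zero hy]
  have h3 := setLIntegral_ball_eq ν (fun w => ‖u w‖ₑ) z hr 1
  rw [mul_one] at h3
  rw [h3, mul_left_comm]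
  gcongr
  calc ‖u z‖ₑ = ENNReal.ofReal J⁻¹ * (‖u z‖ₑ * ENNReal.ofReal J) := by
        rw [mul_comm, mul_assoc, ← ENNReal.ofReal_mul hJ0.le, mul_inv_cancel₀ hJ0.ne']
        simp
    _ ≤ _ := mul_le_mul_right h2 _

end MeanValue

/-! ### Sub-mean-value inequality for all positive powers -/

section SubMean
open InnerProductSpace
variable {E : Type*} [NormedAddCommGroup E] [InnerProductSpace ℝ E] [FiniteDimensional ℝ E]
  [MeasurableSpace E] [BorelSpace E] (ν : Measure E) [ν.IsAddHaarMeasure]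

theorem enorm_rpow_eq_ofReal (x : ℝ) {s : ℝ} (hs : 0 ≤ s) :
    ‖x‖ₑ ^ s = ENNReal.ofReal (|x| ^ s) := by
  rw [← ofReal_norm, Real.norm_eq_abs, ENNReal.ofReal_rpow_of_nonneg (abs_nonneg _) hs]

/-- For every λ > 0, |u| ≤ λ + λ^(1-σ)|u|^σ. Inserted in the case σ = 1 with λ a small multiple of
|u(z)|, the first term is absorbed in the left side. -/
theorem exists_enorm_rpow_le_setLIntegral_ball_of_one_le {σ : ℝ} (hσ : 1 ≤ σ) :
    ∃ C : ℝ≥0, ∀ (u : E → ℝ) (z : E) (R r : ℝ), HarmonicOnNhd u (Metric.ball z R) → 0 < r → r < R →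
      ENNReal.ofReal (r ^ Module.finrank ℝ E) * ‖u z‖ₑ ^ σ ≤
        C * ∫⁻ w in Metric.ball z r, ‖u w‖ₑ ^ σ ∂ν := by
  obtain ⟨C, hC⟩ := exists_enorm_le_setLIntegral_ball ν
  set d := Module.finrank ℝ E
  set V := ν.real (Metric.ball (0 : E) 1) with hV
  have hV0 : 0 ≤ V := measureReal_nonneg
  -- With λ = |u(z)|/K, this choice makes the constant term at most half of the left side.
  set K : ℝ := 2 * C * V + 1 with hK
  have hK0 : 0 < K := by positivity
  refine ⟨Real.toNNReal (2 * C * K ^ (σ - 1) + 1), fun u z R r hu hr hrR => ?_⟩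
  have hσ0 : 0 < σ := by linarith
  by_cases hJ : ∫⁻ w in Metric.ball z r, ‖u w‖ₑ ^ σ ∂ν = ∞
  · rw [hJ, ENNReal.mul_top]
    · exact le_top
    · refine (ENNReal.coe_pos.2 (Real.toNNReal_pos.2 ?_)).ne'
      exact show (0 : ℝ) < 2 * C * K ^ (σ - 1) + 1 by positivity
  obtain ⟨j, hj⟩ : ∃ j : ℝ≥0, (j : ℝ≥0∞) = _ := ⟨_, ENNReal.coe_toNNReal hJ⟩
  rcases eq_or_ne (u z) 0 with h0 | h0
  · simp [h0, hσ0]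
  set X := |u z|
  have hX : 0 < X := abs_pos.2 h0
  have hl : 0 < X / K := by positivity
  have hpt : ∀ w, ‖u w‖ₑ ≤ ENNReal.ofReal (X / K) +
      ENNReal.ofReal ((X / K) ^ (1 - σ)) * ‖u w‖ₑ ^ σ := by
    intro w
    rw [enorm_rpow_eq_ofReal _ hσ0.le, ← ENNReal.ofReal_mul (by positivity),
      ← ENNReal.ofReal_add hl.le (by positivity), ← ofReal_norm, Real.norm_eq_abs]
    refine ENNReal.ofReal_le_ofReal ?_
    rcases le_or_gt |u w| (X / K) with h | h
    · have : 0 ≤ (X / K) ^ (1 - σ) * |u w| ^ σ := by positivity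
      linarith
    · have h2 : |u w| ^ (1 - σ) * |u w| ^ σ = |u w| := by
        rw [← Real.rpow_add (hl.trans h)]; simp
      have h3 : |u w| ^ (1 - σ) ≤ (X / K) ^ (1 - σ) :=
        Real.rpow_le_rpow_of_nonpos hl h.le (by linarith)
      have h4 := mul_le_mul_of_nonneg_right h3 (by positivity : 0 ≤ |u w| ^ σ)
      linarith
  have h1 := (hC u z R r hu hr hrR).trans (mul_le_mul_right (lintegral_mono hpt) _)
  rw [lintegral_add_left measurable_const, setLIntegral_const,
    lintegral_const_mul' _ _ ENNReal.ofReal_ne_top, ← hj,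
    Measure.addHaar_ball_of_pos _ _ hr, ← ofReal_norm, Real.norm_eq_abs,
    ← ENNReal.ofReal_toReal (measure_ball_lt_top (μ := ν) (x := 0) (r := 1)).ne,
    ← ENNReal.ofReal_coe_nnreal, ← ENNReal.ofReal_coe_nnreal,
    ← ENNReal.ofReal_mul (by positivity), ← ENNReal.ofReal_mul (by positivity),
    ← ENNReal.ofReal_mul (by positivity), ← ENNReal.ofReal_mul (by positivity),
    ← ENNReal.ofReal_add (by positivity) (by positivity), ← ENNReal.ofReal_mul (by positivity),
    ENNReal.ofReal_le_ofReal_iff (by positivity)] at h1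
  change r ^ d * X ≤ C * (X / K * (r ^ d * V) + (X / K) ^ (1 - σ) * j) at h1
  rw [← hj, enorm_rpow_eq_ofReal _ hσ0.le, ENNReal.ofNNReal_toNNReal, ← ENNReal.ofReal_coe_nnreal,
    ← ENNReal.ofReal_mul (by positivity), ← ENNReal.ofReal_mul (by positivity)]
  refine ENNReal.ofReal_le_ofReal ?_
  change r ^ d * X ^ σ ≤ (2 * C * K ^ (σ - 1) + 1) * j
  have h2 : C * V * (X / K) ≤ X / 2 := by
    rw [mul_div_assoc', div_le_div_iff₀ hK0 two_pos]
    nlinarith [hX.le]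
  have h3 : r ^ d * (X / 2) ≤ C * ((X / K) ^ (1 - σ) * j) := by
    have : 0 < r ^ d := by positivity
    nlinarith
  have h4 : (X / K) ^ (1 - σ) * X ^ (σ - 1) = K ^ (σ - 1) := by
    rw [Real.div_rpow hX.le hK0.le, div_mul_eq_mul_div, ← Real.rpow_add hX]
    rw [show 1 - σ = -(σ - 1) by ring, Real.rpow_neg hK0.le]
    simp
  have h5 := mul_le_mul_of_nonneg_right h3 (by positivity : 0 ≤ X ^ (σ - 1))
  have h6 : X * X ^ (σ - 1) = X ^ σ := by
    rw [← Real.rpow_one_add' hX.le (by linarith)]; congr 1; ring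
  have hj0 : (0 : ℝ) ≤ j := j.2
  calc r ^ d * X ^ σ = 2 * (r ^ d * (X / 2) * X ^ (σ - 1)) := by rw [← h6]; ring
    _ ≤ 2 * (C * ((X / K) ^ (1 - σ) * j) * X ^ (σ - 1)) := by linarith
    _ = 2 * C * ((X / K) ^ (1 - σ) * X ^ (σ - 1)) * j := by ring
    _ ≤ _ := by rw [h4]; linarith

/-- Let w₀ maximize |u(w)|(r-|w-z|)^γ. On the ball about w₀ of half the distance to the sphere, |u|
≤ 2^γ|u(w₀)|, so |u| is at most a constant times |u(w₀)|^(1-σ)|u|^σ there. The case of exponent 1 at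
w₀ and division by |u(w₀)|^(1-σ) give the bound at w₀, and maximality carries it to z. -/
theorem exists_enorm_rpow_le_setLIntegral_ball_of_lt_one {σ : ℝ} (hσ0 : 0 < σ) (hσ : σ < 1) :
    ∃ C : ℝ≥0, ∀ (u : E → ℝ) (z : E) (R r : ℝ), HarmonicOnNhd u (Metric.ball z R) → 0 < r → r < R →
      ENNReal.ofReal (r ^ Module.finrank ℝ E) * ‖u z‖ₑ ^ σ ≤
        C * ∫⁻ w in Metric.ball z r, ‖u w‖ₑ ^ σ ∂ν := by
  obtain ⟨C, hC⟩ := exists_enorm_le_setLIntegral_ball ν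
  set d := Module.finrank ℝ E
  -- The exponent for which the σ-th power of the weight scales like the volume of a ball, as
  -- `hradius` requires.
  set γ : ℝ := d / σ with hγ
  have hγ0 : 0 ≤ γ := by positivity
  set B : ℝ := 2 ^ d * C * 2 ^ (γ * (1 - σ)) with hB
  have hB0 : 0 ≤ B := by positivity
  refine ⟨Real.toNNReal (B + 1), fun u z R r hu hr hrR => ?_⟩
  by_cases hJ : ∫⁻ w in Metric.ball z r, ‖u w‖ₑ ^ σ ∂ν = ∞
  · rw [hJ, ENNReal.mul_top]
    · exact le_top
    · refine (ENNReal.coe_pos.2 (Real.toNNReal_pos.2 ?_)).ne'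
      exact show (0 : ℝ) < B + 1 by positivity
  obtain ⟨j, hj⟩ : ∃ j : ℝ≥0, (j : ℝ≥0∞) = _ := ⟨_, ENNReal.coe_toNNReal hJ⟩
  rcases eq_or_ne (u z) 0 with h0 | h0
  · simp [h0, hσ0]
  have hX : 0 < |u z| := abs_pos.2 h0
  have hcont : ContinuousOn (fun w => |u w| * (r - dist w z) ^ γ) (Metric.closedBall z r) := by
    refine ((hu.mono (Metric.closedBall_subset_ball hrR)).continuousOn.abs).mul ?_
    exact ContinuousOn.rpow_const (by fun_prop) fun _ _ => Or.inr hγ0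
  obtain ⟨w₀, hw₀, hmax⟩ := (isCompact_closedBall z r).exists_isMaxOn
    ⟨z, Metric.mem_closedBall_self hr.le⟩ hcont
  rw [isMaxOn_iff] at hmax
  rw [Metric.mem_closedBall] at hw₀
  have hz := hmax z (Metric.mem_closedBall_self hr.le)
  simp only [dist_self, sub_zero] at hz
  set Y := |u w₀| with hYdef
  set t := r - dist w₀ z with ht
  have ht0 : 0 ≤ t := by linarith
  have hpos : 0 < Y * t ^ γ := lt_of_lt_of_le (by positivity) hz
  have hY : 0 < Y := (abs_nonneg _).lt_of_ne fun h => by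
    rw [hYdef, ← h, zero_mul] at hpos; exact lt_irrefl _ hpos
  have hradius : r ^ d * |u z| ^ σ ≤ t ^ d * Y ^ σ := by
    have := Real.rpow_le_rpow (by positivity) hz hσ0.le
    rw [Real.mul_rpow (abs_nonneg _) (by positivity), Real.mul_rpow (by positivity) (by positivity),
      ← Real.rpow_mul hr.le, ← Real.rpow_mul ht0, hγ, div_mul_cancel₀ _ hσ0.ne',
      Real.rpow_natCast, Real.rpow_natCast] at this
    linarith
  -- In dimension zero γ = 0, so positivity of the maximum says nothing about t; there w₀ = z and t
  -- = r.
  have htpos : 0 < t := by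
    refine ht0.lt_of_ne fun h => ?_
    rcases Nat.eq_zero_or_pos d with hd | hd
    · have : Subsingleton E := Module.finrank_zero_iff.1 hd
      rw [ht, Subsingleton.elim w₀ z, dist_self] at h
      linarith
    · have : (0 : ℝ) < γ := by positivity
      rw [← h, Real.zero_rpow this.ne', mul_zero] at hpos
      exact lt_irrefl _ hpos
  set δ := t / 2 with hδ
  have hδ0 : 0 < δ := by positivity
  have hsub : Metric.ball w₀ δ ⊆ Metric.ball z r := fun w hw => by
    rw [Metric.mem_ball] at hw ⊢
    have := dist_triangle w w₀ z
    linarith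
  have hpt : ∀ w ∈ Metric.ball w₀ δ, ‖u w‖ₑ ≤
      ENNReal.ofReal ((2 ^ γ * Y) ^ (1 - σ)) * ‖u w‖ₑ ^ σ := by
    intro w hw
    have hwz := hmax w (Metric.ball_subset_closedBall (hsub hw))
    rw [Metric.mem_ball] at hw
    have htri := dist_triangle w w₀ z
    have hlow : δ ≤ r - dist w z := by linarith
    have hbd : |u w| ≤ 2 ^ γ * Y := by
      have h1 : |u w| * δ ^ γ ≤ Y * t ^ γ :=
        (mul_le_mul_of_nonneg_left (Real.rpow_le_rpow hδ0.le hlow hγ0) (abs_nonneg _)).trans hwz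
      have h2 : t ^ γ = 2 ^ γ * δ ^ γ := by
        rw [← Real.mul_rpow two_pos.le hδ0.le]; congr 1; rw [hδ]; ring
      have h3 : 0 < δ ^ γ := by positivity
      rw [h2, ← mul_assoc, mul_comm Y] at h1
      exact le_of_mul_le_mul_right h1 h3
    rw [enorm_rpow_eq_ofReal _ hσ0.le, ← ENNReal.ofReal_mul (by positivity),
      ← ofReal_norm, Real.norm_eq_abs]
    refine ENNReal.ofReal_le_ofReal ?_
    rcases (abs_nonneg (u w)).eq_or_lt with h | h
    · rw [← h]; positivity
    · calc |u w| = |u w| ^ (1 - σ) * |u w| ^ σ := by rw [← Real.rpow_add h]; simp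
        _ ≤ _ := by gcongr
  have h1 := hC u w₀ (R - dist w₀ z) δ
    (hu.mono (Metric.ball_subset_ball' (by linarith))) hδ0 (by linarith)
  have h2 := (setLIntegral_mono' Metric.isOpen_ball.measurableSet hpt).trans
    (lintegral_mono_set (μ := ν) hsub)
  rw [lintegral_const_mul' _ _ ENNReal.ofReal_ne_top, ← hj] at h2
  replace h1 := h1.trans (mul_le_mul_right h2 _)
  rw [← ofReal_norm, Real.norm_eq_abs,
    ← ENNReal.ofReal_coe_nnreal, ← ENNReal.ofReal_coe_nnreal,
    ← ENNReal.ofReal_mul (by positivity), ← ENNReal.ofReal_mul (by positivity),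
    ← ENNReal.ofReal_mul (by positivity), ENNReal.ofReal_le_ofReal_iff (by positivity)] at h1
  change δ ^ d * Y ≤ C * ((2 ^ γ * Y) ^ (1 - σ) * j) at h1
  rw [← hj, enorm_rpow_eq_ofReal _ hσ0.le, ENNReal.ofNNReal_toNNReal, ← ENNReal.ofReal_coe_nnreal,
    ← ENNReal.ofReal_mul (by positivity), ← ENNReal.ofReal_mul (by positivity)]
  refine ENNReal.ofReal_le_ofReal (hradius.trans ?_)
  change t ^ d * Y ^ σ ≤ (B + 1) * j
  have hj0 : (0 : ℝ) ≤ j := j.2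
  have h4 : (2 ^ γ * Y) ^ (1 - σ) * Y ^ (σ - 1) = 2 ^ (γ * (1 - σ)) := by
    rw [Real.mul_rpow (by positivity) hY.le, mul_assoc, ← Real.rpow_add hY, ← Real.rpow_mul two_pos.le]
    simp
  have h6 : Y * Y ^ (σ - 1) = Y ^ σ := by
    rw [← Real.rpow_one_add' hY.le (by linarith)]; congr 1; ring
  have htd : t ^ d = 2 ^ d * δ ^ d := by rw [← mul_pow, hδ]; congr 1; ring
  calc t ^ d * Y ^ σ = 2 ^ d * (δ ^ d * Y) * Y ^ (σ - 1) := by rw [← h6, htd]; ring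
    _ ≤ 2 ^ d * (C * ((2 ^ γ * Y) ^ (1 - σ) * j)) * Y ^ (σ - 1) := by gcongr
    _ = 2 ^ d * C * ((2 ^ γ * Y) ^ (1 - σ) * Y ^ (σ - 1)) * j := by ring
    _ = B * j := by rw [h4]
    _ ≤ _ := by linarith

/-- The powers `|u|^σ`, `σ > 0`, of the modulus of a harmonic function satisfy a sub-mean-value
inequality over balls. -/
theorem exists_enorm_rpow_le_setLIntegral_ball {σ : ℝ} (hσ : 0 < σ) :
    ∃ C : ℝ≥0, ∀ (u : E → ℝ) (z : E) (R r : ℝ), HarmonicOnNhd u (Metric.ball z R) → 0 < r → r < R →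
      ENNReal.ofReal (r ^ Module.finrank ℝ E) * ‖u z‖ₑ ^ σ ≤
        C * ∫⁻ w in Metric.ball z r, ‖u w‖ₑ ^ σ ∂ν :=
  (lt_or_ge σ 1).elim (exists_enorm_rpow_le_setLIntegral_ball_of_lt_one ν hσ)
    (exists_enorm_rpow_le_setLIntegral_ball_of_one_le ν)

end SubMean

/-! ### Cubes, heights and Whitney geometry -/

section Geometry
variable {n : ℕ}

theorem height_eq_proj : (height : AmbientSpace n → ℝ) = EuclideanSpace.proj (𝕜 := ℝ) (Fin.last n) :=
  rfl

theorem continuous_height : Continuous (height : AmbientSpace n → ℝ) := by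
  rw [height_eq_proj]; exact ContinuousLinearMap.continuous _

theorem isOpen_upperHalf : IsOpen (upperHalf n) := isOpen_lt continuous_const continuous_height

theorem abs_apply_le_norm (z : AmbientSpace n) (i : Fin (n + 1)) : |z i| ≤ ‖z‖ :=
  PiLp.norm_apply_le z i

theorem abs_apply_sub_le_dist (z w : AmbientSpace n) (i : Fin (n + 1)) : |z i - w i| ≤ dist z w := by
  rw [dist_eq_norm]; exact abs_apply_le_norm (z - w) i

theorem abs_height_sub_le_dist (z w : AmbientSpace n) : |height z - height w| ≤ dist z w :=
  abs_apply_sub_le_dist z w _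

theorem norm_le_of_abs_apply_le {z : AmbientSpace n} {a : ℝ} (ha : 0 ≤ a) (h : ∀ i, |z i| ≤ a) :
    ‖z‖ ≤ (n + 1) * a := by
  refine le_of_sq_le_sq ?_ (by positivity)
  rw [EuclideanSpace.norm_sq_eq]
  calc ∑ i, ‖z i‖ ^ 2 ≤ ∑ _i : Fin (n + 1), a ^ 2 := by gcongr with i; exact h i
    _ = (n + 1) * a ^ 2 := by simp
    _ ≤ ((n + 1) * a) ^ 2 := by
      rw [mul_pow]
      gcongr
      nlinarith [n.cast_nonneg (α := ℝ)]

theorem dist_le_of_mem_axisCube {c z : AmbientSpace n} {ℓ : ℝ} (hℓ : 0 ≤ ℓ)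
    (hz : z ∈ axisCube c ℓ) : dist z c ≤ (n + 1) * (ℓ / 2) := by
  rw [dist_eq_norm]
  exact norm_le_of_abs_apply_le (by positivity) fun i => hz i

theorem isClosed_axisCube (c : AmbientSpace n) (ℓ : ℝ) : IsClosed (axisCube c ℓ) := by
  simp only [axisCube, ofPred_forall]
  exact isClosed_iInter fun i => isClosed_le (by fun_prop) continuous_const

theorem axisCube_subset_closedBall (c : AmbientSpace n) {ℓ : ℝ} (hℓ : 0 ≤ ℓ) :
    axisCube c ℓ ⊆ Metric.closedBall c ((n + 1) * (ℓ / 2)) :=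
  fun _ hz => dist_le_of_mem_axisCube hℓ hz

theorem isCompact_axisCube (c : AmbientSpace n) {ℓ : ℝ} (hℓ : 0 ≤ ℓ) : IsCompact (axisCube c ℓ) :=
  (isCompact_closedBall c _).of_isClosed_subset (isClosed_axisCube c ℓ)
    (axisCube_subset_closedBall c hℓ)

theorem self_mem_axisCube (c : AmbientSpace n) {ℓ : ℝ} (hℓ : 0 ≤ ℓ) : c ∈ axisCube c ℓ :=
  fun i => by rw [sub_self, abs_zero]; positivity

theorem frontier_upperHalf : frontier (upperHalf n) = {z | height z = 0} := by
  have hopen : IsOpenMap (height : AmbientSpace n → ℝ) := by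
    rw [height_eq_proj]
    refine ContinuousLinearMap.isOpenMap _ fun t => ⟨EuclideanSpace.single (Fin.last n) t, ?_⟩
    simp
  have := hopen.preimage_frontier_eq_frontier_preimage continuous_height (Ioi (0 : ℝ))
  rw [frontier_Ioi] at this
  exact this.symm

/-- The point above `c` at signed vertical distance `t`. -/
noncomputable def verticalShift (c : AmbientSpace n) (t : ℝ) : AmbientSpace n :=
  c + EuclideanSpace.single (Fin.last n) t

theorem height_verticalShift (c : AmbientSpace n) (t : ℝ) :
    height (verticalShift c t) = height c + t := by
  simp [verticalShift, height]

theorem dist_verticalShift (c : AmbientSpace n) (s t : ℝ) :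
    dist (verticalShift c s) (verticalShift c t) = |s - t| := by
  simp [verticalShift, Real.dist_eq]

theorem verticalShift_mem_axisCube (c : AmbientSpace n) {t ℓ : ℝ} (h : |t| ≤ ℓ / 2) :
    verticalShift c t ∈ axisCube c ℓ := by
  intro i
  by_cases hi : i = Fin.last n
  · subst hi; simpa [verticalShift] using h
  · simpa [verticalShift, hi] using (abs_nonneg t).trans h

variable {ζ : ℕ → AmbientSpace n} {ℓ : ℕ → ℝ}

theorem IsWhitneyDecomposition.axisCube_subset (hΔ : IsWhitneyDecomposition ζ ℓ) (k : ℕ) :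
    axisCube (ζ k) (ℓ k) ⊆ upperHalf n :=
  (subset_iUnion (fun k => axisCube (ζ k) (ℓ k)) k).trans hΔ.iUnion_eq.subset

/-- In a Whitney decomposition, side length and distance from the boundary are comparable to the
height of the center. -/
theorem IsWhitneyDecomposition.exists_comparable (hΔ : IsWhitneyDecomposition ζ ℓ) :
    ∃ ε : ℝ, 0 < ε ∧ ∀ k, 0 < height (ζ k) ∧ ε * height (ζ k) ≤ ℓ k ∧ ℓ k ≤ 2 * height (ζ k) ∧
      ε * height (ζ k) ≤ height (ζ k) - ℓ k / 2 := by
  obtain ⟨c, C, hc, hC, h⟩ := hΔ.diam_comparable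
  set D : ℝ := n + 1 with hD
  have hD0 : 0 < D := by positivity
  -- With dist = η - ℓ/2 and ℓ ≤ diam ≤ Dℓ, the two comparabilities become η ≤ (1/2 + D/c)ℓ and η ≤
  -- (1 + C/2)(η - ℓ/2).
  refine ⟨min (1 / (1 / 2 + D / c)) (1 / (1 + C / 2)), by positivity, fun k => ?_⟩
  have hℓ := hΔ.side_pos k
  set η := height (ζ k) with hη
  have hlow : verticalShift (ζ k) (-(ℓ k / 2)) ∈ axisCube (ζ k) (ℓ k) :=
    verticalShift_mem_axisCube _ (by rw [abs_neg, abs_of_pos (by positivity)])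
  have hhigh : verticalShift (ζ k) (ℓ k / 2) ∈ axisCube (ζ k) (ℓ k) :=
    verticalShift_mem_axisCube _ (by rw [abs_of_pos (by positivity)])
  have hbot : verticalShift (ζ k) (-η) ∈ frontier (upperHalf n) := by
    rw [frontier_upperHalf, mem_ofPred_eq, height_verticalShift, ← hη]; ring
  have hpos : 0 < η - ℓ k / 2 := by
    have : 0 < height (verticalShift (ζ k) (-(ℓ k / 2))) := hΔ.axisCube_subset k hlow
    rw [height_verticalShift] at this
    linarith
  -- The distance is attained on the vertical segment from the midpoint of the bottom face to the
  -- boundary.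
  have hdist : setDist (axisCube (ζ k) (ℓ k)) (frontier (upperHalf n)) = η - ℓ k / 2 := by
    refine le_antisymm ?_ ?_
    · refine (csInf_le ⟨0, ?_⟩ (mem_image2_of_mem hlow hbot)).trans_eq ?_
      · rintro _ ⟨a, -, b, -, rfl⟩
        exact dist_nonneg
      · rw [dist_verticalShift, abs_of_pos (by linarith)]; ring
    · refine le_csInf ⟨_, mem_image2_of_mem hlow hbot⟩ ?_
      rintro _ ⟨a, ha, b, hb, rfl⟩
      rw [frontier_upperHalf, mem_ofPred_eq] at hb
      have h1 := (abs_le.1 (ha (Fin.last n))).1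
      have h2 := (abs_le.1 (abs_height_sub_le_dist a b)).2
      change _ ≤ height a - height (ζ k) at h1
      linarith
  have hdiam1 : ℓ k ≤ Metric.diam (axisCube (ζ k) (ℓ k)) := by
    have := Metric.dist_le_diam_of_mem (isCompact_axisCube (ζ k) hℓ.le).isBounded hhigh hlow
    rw [dist_verticalShift, abs_of_pos (by linarith)] at this
    linarith
  have hdiam2 : Metric.diam (axisCube (ζ k) (ℓ k)) ≤ D * ℓ k := by
    refine Metric.diam_le_of_forall_dist_le (by positivity) fun a ha b hb => ?_
    have h1 := dist_le_of_mem_axisCube hℓ.le ha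
    have h2 := dist_le_of_mem_axisCube hℓ.le hb
    have := dist_triangle_right a b (ζ k)
    linarith
  obtain ⟨h1, h2⟩ := h k
  rw [hdist] at h1 h2
  have hη0 : 0 < η := by linarith
  refine ⟨hη0, ?_, by linarith, ?_⟩
  · refine (mul_le_mul_of_nonneg_right (min_le_left _ _) hη0.le).trans ?_
    rw [one_div_mul_eq_div, div_le_iff₀ (by positivity)]
    have : c * (η - ℓ k / 2) ≤ D * ℓ k := h1.trans hdiam2
    have h3 : η - ℓ k / 2 ≤ D * ℓ k / c := by rwa [le_div_iff₀ hc, mul_comm]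
    calc η ≤ D * ℓ k / c + ℓ k / 2 := by linarith
      _ = _ := by ring
  · refine (mul_le_mul_of_nonneg_right (min_le_right _ _) hη0.le).trans ?_
    rw [one_div_mul_eq_div, div_le_iff₀ (by positivity)]
    have : ℓ k ≤ C * (η - ℓ k / 2) := hdiam1.trans h2
    linarith

end Geometry

/-! ### Inequalities for powers, series and overlapping sets -/

/-- A number in `[K⁻¹, K]` has its powers in `[K^{-|a|}, K^{|a|}]`. -/
theorem rpow_mem_Icc_of_mem_Icc {x K : ℝ} (hK : 1 ≤ K) (h1 : K⁻¹ ≤ x) (h2 : x ≤ K) (a : ℝ) :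
    K ^ (-|a|) ≤ x ^ a ∧ x ^ a ≤ K ^ |a| := by
  have hK0 : 0 < K := by linarith
  have hx : 0 < x := (inv_pos.2 hK0).trans_le h1
  have hlog : |Real.log x| ≤ Real.log K := by
    rw [abs_le]
    exact ⟨by rw [← Real.log_inv]; exact Real.log_le_log (inv_pos.2 hK0) h1,
      Real.log_le_log hx h2⟩
  have h := abs_mul (Real.log x) a
  have h3 : |Real.log x * a| ≤ Real.log K * |a| := by
    rw [h]; exact mul_le_mul_of_nonneg_right hlog (abs_nonneg a)
  rw [abs_le] at h3
  rw [Real.rpow_def_of_pos hx, Real.rpow_def_of_pos hK0, Real.rpow_def_of_pos hK0]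
  constructor <;> apply Real.exp_le_exp.2 <;> linarith

/-- Keep one factor and bound each term of the others by its full sum. An index is needed: the empty
product would make the left side a series of ones. -/
theorem ENNReal.tsum_prod_le_prod_tsum {ι κ : Type*} [Fintype ι] [Nonempty ι] (a : ι → κ → ℝ≥0∞) :
    ∑' k, ∏ i, a i k ≤ ∏ i, ∑' k, a i k := by
  classical
  obtain ⟨j⟩ := ‹Nonempty ι›
  rw [← Finset.mul_prod_erase _ _ (Finset.mem_univ j), ← ENNReal.tsum_mul_right]
  refine ENNReal.tsum_le_tsum fun k => ?_
  rw [← Finset.mul_prod_erase _ _ (Finset.mem_univ j)]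
  gcongr
  exact ENNReal.le_tsum k

/-- Integrals over sets of overlap at most `N` add up to at most `N` times the whole integral. -/
theorem tsum_setLIntegral_le_of_encard_le {X : Type*} [MeasurableSpace X] {ν : Measure X}
    {B : ℕ → Set X} {H : Set X} {N : ℕ} (hB : ∀ k, MeasurableSet (B k)) (hH : MeasurableSet H)
    (hBH : ∀ k, B k ⊆ H) (hN : ∀ x ∈ H, {k | x ∈ B k}.encard ≤ N) (G : X → ℝ≥0∞) :
    ∑' k, ∫⁻ x in B k, G x ∂ν ≤ N * ∫⁻ x in H, G x ∂ν := by
  -- Comparing measures instead of integrands avoids any measurability assumption on G.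
  have hle : Measure.sum (fun k => ν.restrict (B k)) ≤ (N : ℝ≥0∞) • ν.restrict H := by
    refine Measure.le_iff.2 fun s hs => ?_
    rw [Measure.sum_apply _ hs, Measure.smul_apply, smul_eq_mul, Measure.restrict_apply hs]
    have h1 : ∀ k, ν.restrict (B k) s = ∫⁻ x, (s ∩ B k).indicator 1 x ∂ν := fun k => by
      rw [Measure.restrict_apply hs, lintegral_indicator_one (hs.inter (hB k))]
    simp only [h1]
    rw [← lintegral_tsum fun k => (measurable_one.indicator (hs.inter (hB k))).aemeasurable,
      ← lintegral_indicator_one (hs.inter hH), ← lintegral_const_mul' _ _ (by simp)]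
    refine lintegral_mono fun x => ?_
    by_cases hx : x ∈ s ∩ H
    · have : ∀ k, (s ∩ B k).indicator (1 : X → ℝ≥0∞) x = {k | x ∈ B k}.indicator 1 k := fun k => by
        by_cases h : x ∈ B k <;> simp [indicator, h, hx.1]
      simp only [this]
      rw [← tsum_subtype, indicator_of_mem hx]
      simp only [Pi.one_apply, mul_one, ENNReal.tsum_set_one]
      exact_mod_cast hN x hx.2
    · have : ∀ k, (s ∩ B k).indicator (1 : X → ℝ≥0∞) x = 0 := fun k =>
        indicator_of_notMem (fun h => hx ⟨h.1, hBH k h.2⟩) _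
      simp [this]
  rw [← lintegral_sum_measure]
  exact (lintegral_mono' hle le_rfl).trans_eq (lintegral_smul_measure _ _)

/-! ### The measure bound implies the norm inequality -/

section Sufficiency
open InnerProductSpace
variable {n : ℕ}

theorem ball_subset_upperHalf {z : AmbientSpace n} {r : ℝ} (hr : r ≤ height z) :
    Metric.ball z r ⊆ upperHalf n := fun w hw => by
  rw [Metric.mem_ball] at hw
  have := (abs_le.1 (abs_height_sub_le_dist w z)).1
  change 0 < height w
  linarith

/-- The weighted integral over `Q_w` controls the value of a harmonic function at a point
near `w`. -/
theorem exists_enorm_rpow_le_setLIntegral_heightCube {σ : ℝ} (α : ℝ) (hσ : 0 < σ) {ε : ℝ}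
    (hε : 0 < ε) :
    ∃ c C : ℝ, 0 < c ∧ 0 ≤ C ∧ ∀ f : AmbientSpace n → ℝ, HarmonicOnNhd f (upperHalf n) →
      ∀ (z w : AmbientSpace n) (η : ℝ), 0 < η → ε * η ≤ height z → height z ≤ 2 * η →
        w ∈ Metric.ball z (ε * η / 8) →
        ENNReal.ofReal (c * η ^ ((n : ℝ) + 1 + α)) * ‖f z‖ₑ ^ σ ≤
          ENNReal.ofReal C *
            ∫⁻ x in heightCube w, ‖f x‖ₑ ^ σ * ENNReal.ofReal (height x ^ α) := by
  obtain ⟨C, hC⟩ := exists_enorm_rpow_le_setLIntegral_ball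
    (volume : Measure (AmbientSpace n)) hσ
  -- Heights in the ball about z lie between εη/2 and 3η.
  set K : ℝ := max 3 (2 / ε) with hK
  have hK1 : 1 ≤ K := le_trans (by norm_num) (le_max_left _ _)
  have hK0 : 0 < K := by linarith
  refine ⟨K ^ (-|α|) * (ε / 8) ^ (n + 1), C, by positivity, C.2, fun f hf z w η hη h1 h2 hw => ?_⟩
  set δ := ε * η / 8 with hδ
  have hδ0 : 0 < δ := by positivity
  have hhz : ∀ x, dist x z < δ → |height x - height z| < δ := fun x hx =>
    (abs_height_sub_le_dist x z).trans_lt hx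
  rw [Metric.mem_ball] at hw
  -- Coordinates of x and w differ by less than 2δ = εη/4, while half the side of Q_w exceeds
  -- 7εη/16.
  have hsub : Metric.ball z δ ⊆ heightCube w := fun x hx i => by
    rw [Metric.mem_ball] at hx
    have e1 := (abs_apply_sub_le_dist x w i).trans (dist_triangle_right x w z)
    have e2 := (abs_lt.1 (hhz w hw)).1
    linarith
  have hpow : ∀ x ∈ Metric.ball z δ, K ^ (-|α|) * η ^ α ≤ height x ^ α := by
    intro x hx
    have e := abs_lt.1 (hhz x hx)
    have hx2 : ε * η / 2 ≤ height x := by linarith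
    have hx3 : height x ≤ 3 * η := by
      have : ε * η ≤ 2 * η := h1.trans h2
      linarith
    have hx0 : 0 < height x := lt_of_lt_of_le (by positivity) hx2
    have h3 : K⁻¹ ≤ height x / η := by
      rw [inv_le_comm₀ hK0 (by positivity), inv_div]
      refine le_trans ?_ (le_max_right _ _)
      rw [div_le_div_iff₀ hx0 hε]
      linarith
    have h4 : height x / η ≤ K := by
      refine le_trans ?_ (le_max_left _ _)
      rwa [div_le_iff₀ hη]
    have h5 := (rpow_mem_Icc_of_mem_Icc hK1 h3 h4 α).1
    rwa [Real.div_rpow hx0.le hη.le, le_div_iff₀ (by positivity)] at h5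
  have h5 := hC f z (ε * η) δ (hf.mono (ball_subset_upperHalf h1)) hδ0
    (by rw [hδ]; linarith [mul_pos hε hη])
  rw [finrank_euclideanSpace_fin] at h5
  have h6 : ENNReal.ofReal (K ^ (-|α|) * η ^ α) * ∫⁻ x in Metric.ball z δ, ‖f x‖ₑ ^ σ ≤
      ∫⁻ x in heightCube w, ‖f x‖ₑ ^ σ * ENNReal.ofReal (height x ^ α) := by
    rw [← lintegral_const_mul' _ _ ENNReal.ofReal_ne_top]
    refine le_trans ?_ (lintegral_mono_set hsub)
    refine setLIntegral_mono' Metric.isOpen_ball.measurableSet fun x hx => ?_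
    rw [mul_comm]
    gcongr
    exact hpow x hx
  have e : K ^ (-|α|) * (ε / 8) ^ (n + 1) * η ^ ((n : ℝ) + 1 + α) =
      (K ^ (-|α|) * η ^ α) * δ ^ (n + 1) := by
    rw [Real.rpow_add hη, ← Nat.cast_add_one, Real.rpow_natCast, hδ]
    rw [show ε * η / 8 = ε / 8 * η by ring, mul_pow]
    ring
  rw [e, ENNReal.ofReal_mul (by positivity), ENNReal.ofReal_coe_nnreal, mul_assoc]
  calc _ ≤ ENNReal.ofReal (K ^ (-|α|) * η ^ α) * (C * ∫⁻ x in Metric.ball z δ, ‖f x‖ₑ ^ σ) := by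
        gcongr
    _ = C * (ENNReal.ofReal (K ^ (-|α|) * η ^ α) * ∫⁻ x in Metric.ball z δ, ‖f x‖ₑ ^ σ) :=
        mul_left_comm _ _ _
    _ ≤ _ := by gcongr

/-- The pointwise bound, raised to the power q/σ, has a left side independent of w. Integration over
the ball multiplies that side by a volume ≍ η^(n+1), the source of the first n+1 in the exponent. -/
theorem exists_enorm_rpow_le_setLIntegral_ball_heightCube {q σ : ℝ} (α : ℝ) (hq : 0 < q)
    (hσ : 0 < σ) {ε : ℝ} (hε : 0 < ε) :
    ∃ C : ℝ≥0, ∀ f : AmbientSpace n → ℝ, HarmonicOnNhd f (upperHalf n) →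
      ∀ (z : AmbientSpace n) (η : ℝ), 0 < η → ε * η ≤ height z → height z ≤ 2 * η →
        ‖f z‖ₑ ^ q * ENNReal.ofReal (η ^ ((n : ℝ) + 1 + (n + 1 + α) * q / σ)) ≤
          C * ∫⁻ w in Metric.ball z (ε * η / 8),
            (∫⁻ x in heightCube w, ‖f x‖ₑ ^ σ * ENNReal.ofReal (height x ^ α)) ^ (q / σ) := by
  obtain ⟨c, C, hc, hC0, hC⟩ := exists_enorm_rpow_le_setLIntegral_heightCube (n := n) α hσ hε
  set V := (volume : Measure (AmbientSpace n)).real (Metric.ball 0 1) with hV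
  have hVt : (volume : Measure (AmbientSpace n)) (Metric.ball 0 1) ≠ ∞ := measure_ball_lt_top.ne
  have hV0 : 0 < V := ENNReal.toReal_pos (Metric.measure_ball_pos _ _ one_pos).ne' hVt
  have hqσ : 0 < q / σ := by positivity
  set b : ℝ := c ^ (q / σ) * ((ε / 8) ^ (n + 1) * V) with hb
  have hb0 : 0 < b := by positivity
  refine ⟨Real.toNNReal (b⁻¹ * C ^ (q / σ)), fun f hf z η hη h1 h2 => ?_⟩
  set G : AmbientSpace n → ℝ≥0∞ := fun w =>
    (∫⁻ x in heightCube w, ‖f x‖ₑ ^ σ * ENNReal.ofReal (height x ^ α)) ^ (q / σ)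
  have h3 : ∀ w ∈ Metric.ball z (ε * η / 8),
      ENNReal.ofReal ((c * η ^ ((n : ℝ) + 1 + α)) ^ (q / σ)) * ‖f z‖ₑ ^ q ≤
        ENNReal.ofReal (C ^ (q / σ)) * G w := by
    intro w hw
    have := ENNReal.rpow_le_rpow (hC f hf z w η hη h1 h2 hw) hqσ.le
    rwa [ENNReal.mul_rpow_of_nonneg _ _ hqσ.le, ENNReal.mul_rpow_of_nonneg _ _ hqσ.le,
      ENNReal.ofReal_rpow_of_nonneg (by positivity) hqσ.le,
      ENNReal.ofReal_rpow_of_nonneg hC0 hqσ.le, ← ENNReal.rpow_mul,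
      mul_div_cancel₀ _ hσ.ne'] at this
  have h4 := setLIntegral_mono' (μ := volume) Metric.isOpen_ball.measurableSet h3
  rw [setLIntegral_const, lintegral_const_mul' _ _ ENNReal.ofReal_ne_top,
    Measure.addHaar_ball_of_pos _ _ (by positivity), ← ENNReal.ofReal_toReal hVt,
    finrank_euclideanSpace_fin, ← ENNReal.ofReal_mul (by positivity), mul_right_comm,
    ← ENNReal.ofReal_mul (by positivity)] at h4
  have e : (c * η ^ ((n : ℝ) + 1 + α)) ^ (q / σ) * ((ε * η / 8) ^ (n + 1) * V) =
      b * η ^ ((n : ℝ) + 1 + (n + 1 + α) * q / σ) := by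
    rw [Real.mul_rpow hc.le (by positivity), ← Real.rpow_mul hη.le, Real.rpow_add hη _ (_ / _),
      ← Nat.cast_add_one, Real.rpow_natCast, hb, show ε * η / 8 = ε / 8 * η by ring, mul_pow,
      mul_div_assoc _ q σ]
    ring
  change ENNReal.ofReal (_ * (_ * V)) * _ ≤ _ at h4
  rw [e, ENNReal.ofReal_mul hb0.le] at h4
  rw [ENNReal.ofNNReal_toNNReal, ENNReal.ofReal_mul (by positivity), mul_assoc]
  calc _ = ENNReal.ofReal b⁻¹ * (ENNReal.ofReal b *
          ENNReal.ofReal (η ^ ((n : ℝ) + 1 + (n + 1 + α) * q / σ)) * ‖f z‖ₑ ^ q) := by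
        rw [← mul_assoc, ← mul_assoc, ← ENNReal.ofReal_mul (by positivity),
          inv_mul_cancel₀ hb0.ne', ENNReal.ofReal_one, one_mul, mul_comm]
    _ ≤ _ := mul_le_mul_right h4 _

variable {ζ : ℕ → AmbientSpace n} {ℓ : ℕ → ℝ}

/-- Sampling a harmonic function at one point of each Whitney cube. -/
theorem IsWhitneyDecomposition.exists_tsum_enorm_rpow_le (hΔ : IsWhitneyDecomposition ζ ℓ)
    {q σ : ℝ} (α : ℝ) (hq : 0 < q) (hσ : 0 < σ) :
    ∃ C : ℝ≥0, ∀ f : AmbientSpace n → ℝ, HarmonicOnNhd f (upperHalf n) →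
      ∀ z : ℕ → AmbientSpace n, (∀ k, z k ∈ axisCube (ζ k) (ℓ k)) →
        ∑' k, ‖f (z k)‖ₑ ^ q *
            ENNReal.ofReal (height (ζ k) ^ ((n : ℝ) + 1 + (n + 1 + α) * q / σ)) ≤
          C * cubeAverageNormPow q σ α f := by
  obtain ⟨ε, hε, hcomp⟩ := hΔ.exists_comparable
  obtain ⟨N, hN⟩ := hΔ.finite_overlap
  obtain ⟨C, hC⟩ := exists_enorm_rpow_le_setLIntegral_ball_heightCube (n := n) α hq hσ hε
  refine ⟨C * N, fun f hf z hz => ?_⟩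
  have hlow : ∀ k, ε * height (ζ k) ≤ height (z k) := fun k => by
    have h1 := (abs_le.1 (hz k (Fin.last n))).1
    change _ ≤ height (z k) - height (ζ k) at h1
    have := (hcomp k).2.2.2
    linarith
  have hup : ∀ k, height (z k) ≤ 2 * height (ζ k) := fun k => by
    have h1 := (abs_le.1 (hz k (Fin.last n))).2
    change height (z k) - height (ζ k) ≤ _ at h1
    have := (hcomp k).2.2.1
    linarith
  have hεη : ∀ k, 0 < ε * height (ζ k) := fun k => mul_pos hε (hcomp k).1
  have hsub : ∀ k, Metric.ball (z k) (ε * height (ζ k) / 8) ⊆ upperHalf n := fun k =>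
    ball_subset_upperHalf (by linarith [hlow k, hεη k])
  -- The radius is at most ℓ/8, exactly the margin between the cube and its 5/4 enlargement.
  have hcube : ∀ k, Metric.ball (z k) (ε * height (ζ k) / 8) ⊆ axisCube (ζ k) (5 / 4 * ℓ k) := by
    intro k x hx i
    rw [Metric.mem_ball] at hx
    have h1 := abs_apply_sub_le_dist x (z k) i
    have h2 := hz k i
    have h3 := abs_sub_le (x i) (z k i) (ζ k i)
    have := (hcomp k).2.1
    linarith
  have hover := tsum_setLIntegral_le_of_encard_le (ν := volume)
    (fun k => (Metric.isOpen_ball (x := z k) (ε := ε * height (ζ k) / 8)).measurableSet)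
    isOpen_upperHalf.measurableSet hsub
    (fun x hx => (encard_le_encard (fun k hk => hcube k hk)).trans (hN x hx))
    (fun w => (∫⁻ x in heightCube w, ‖f x‖ₑ ^ σ * ENNReal.ofReal (height x ^ α)) ^ (q / σ))
  calc _ ≤ ∑' k, C * ∫⁻ w in Metric.ball (z k) (ε * height (ζ k) / 8),
            (∫⁻ x in heightCube w, ‖f x‖ₑ ^ σ * ENNReal.ofReal (height x ^ α)) ^ (q / σ) :=
        ENNReal.tsum_le_tsum fun k => hC f hf (z k) _ (hcomp k).1 (hlow k) (hup k)
    _ ≤ _ := by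
        rw [ENNReal.tsum_mul_left, ENNReal.coe_mul, mul_assoc]
        exact mul_le_mul_right hover _

/-- Raised to the power q/p, the bound on μ thus splits into one weight for each function, the
weight of the sampling inequality. -/
theorem rpow_exponent_eq_sum {m : ℕ} {p q : ℝ} (hp : 0 < p) (hq : 0 < q) (σ α : Fin m → ℝ) :
    ((m : ℝ) * (n + 1) * p / q + ∑ i, p * (n + 1 + α i) / σ i) * (q / p) =
      ∑ i, ((n : ℝ) + 1 + (n + 1 + α i) * q / σ i) := by
  rw [Finset.sum_add_distrib, add_mul, Finset.sum_mul]
  congr 1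
  · simp; field_simp
  · refine Finset.sum_congr rfl fun i _ => ?_
    field_simp

/-- On each cube every |f_i| is replaced by its maximum, at a point depending on i. The k-th term is
then at most a product over i of sampled values with their weights, and the sampling inequality
applies to each i separately. -/
theorem IsWhitneyDecomposition.multiNormPow_le_of_measure_le (hΔ : IsWhitneyDecomposition ζ ℓ)
    {m : ℕ} (hm : 1 ≤ m) {p q : ℝ} (hp : 0 < p) (hq : 0 < q) {σ α : Fin m → ℝ}
    (hσ : ∀ i, 0 < σ i) {μ : Measure (AmbientSpace n)} {C : ℝ≥0}
    (hμ : ∀ k, μ (axisCube (ζ k) (ℓ k)) ≤ C * ENNReal.ofReal (height (ζ k) ^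
        ((m : ℝ) * (n + 1) * p / q + ∑ i, p * (n + 1 + α i) / σ i))) :
    ∃ C : ℝ≥0, ∀ f : Fin m → AmbientSpace n → ℝ, (∀ i, HarmonicOnNhd (f i) (upperHalf n)) →
      multiNormPow ζ ℓ p q μ f ≤ C * ∏ i, cubeAverageNormPow q (σ i) (α i) (f i) := by
  choose D hD using fun i => hΔ.exists_tsum_enorm_rpow_le (α i) hq (hσ i)
  have hqp : 0 < q / p := by positivity
  refine ⟨C ^ (q / p) * ∏ i, D i, fun f hf => ?_⟩
  have hmax : ∀ i k, ∃ z ∈ axisCube (ζ k) (ℓ k), ∀ x ∈ axisCube (ζ k) (ℓ k), ‖f i x‖ₑ ≤ ‖f i z‖ₑ := by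
    intro i k
    have hc := ((hf i).mono (hΔ.axisCube_subset k)).continuousOn
    obtain ⟨z, hz, hzmax⟩ := (isCompact_axisCube (ζ k) (hΔ.side_pos k).le).exists_isMaxOn
      ⟨_, self_mem_axisCube (ζ k) (hΔ.side_pos k).le⟩ hc.enorm
    exact ⟨z, hz, isMaxOn_iff.1 hzmax⟩
  choose z hz hzmax using hmax
  have hη : ∀ k, 0 < height (ζ k) := fun k =>
    hΔ.axisCube_subset k (self_mem_axisCube (ζ k) (hΔ.side_pos k).le)
  set a : Fin m → ℕ → ℝ≥0∞ := fun i k => ‖f i (z i k)‖ₑ ^ q *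
    ENNReal.ofReal (height (ζ k) ^ ((n : ℝ) + 1 + (n + 1 + α i) * q / σ i)) with ha
  have hterm : ∀ k, (∫⁻ x in axisCube (ζ k) (ℓ k), ∏ i, ‖f i x‖ₑ ^ p ∂μ) ^ (q / p) ≤
      (C ^ (q / p) : ℝ≥0) * ∏ i, a i k := by
    intro k
    have h1 : ∫⁻ x in axisCube (ζ k) (ℓ k), ∏ i, ‖f i x‖ₑ ^ p ∂μ ≤
        (∏ i, ‖f i (z i k)‖ₑ ^ p) * μ (axisCube (ζ k) (ℓ k)) := by
      rw [← setLIntegral_const]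
      refine setLIntegral_mono' (isClosed_axisCube _ _).measurableSet fun x hx => ?_
      gcongr with i
      exact hzmax i k x hx
    refine (ENNReal.rpow_le_rpow (h1.trans (mul_le_mul_right (hμ k) _)) hqp.le).trans_eq ?_
    rw [ENNReal.mul_rpow_of_nonneg _ _ hqp.le, ENNReal.mul_rpow_of_nonneg _ _ hqp.le,
      ENNReal.coe_rpow_of_nonneg _ hqp.le,
      ENNReal.ofReal_rpow_of_nonneg (Real.rpow_nonneg (hη k).le _) hqp.le,
      ← Real.rpow_mul (hη k).le, rpow_exponent_eq_sum hp hq, Real.rpow_sum_of_pos (hη k),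
      ENNReal.ofReal_prod_of_nonneg fun i _ => Real.rpow_nonneg (hη k).le _,
      ← ENNReal.prod_rpow_of_nonneg hqp.le, mul_left_comm, ← Finset.prod_mul_distrib]
    congr 1
    refine Finset.prod_congr rfl fun i _ => ?_
    rw [ha, ← ENNReal.rpow_mul, mul_div_cancel₀ _ hp.ne']
  have : Nonempty (Fin m) := ⟨⟨0, hm⟩⟩
  calc multiNormPow ζ ℓ p q μ f ≤ ∑' k, (C ^ (q / p) : ℝ≥0) * ∏ i, a i k :=
        ENNReal.tsum_le_tsum hterm
    _ ≤ (C ^ (q / p) : ℝ≥0) * ∏ i, (D i * cubeAverageNormPow q (σ i) (α i) (f i)) := by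
        rw [ENNReal.tsum_mul_left]
        refine mul_le_mul_right ((ENNReal.tsum_prod_le_prod_tsum a).trans ?_) _
        exact Finset.prod_le_prod' fun i _ => hD i (f i) (hf i) (z i) (hz i)
    _ = _ := by
        rw [Finset.prod_mul_distrib, ENNReal.coe_mul, ENNReal.ofNNReal_finsetProd, mul_assoc]

end Sufficiency

/-! ### Kelvin transforms of isotropic powers are harmonic -/

section Kelvin
open InnerProductSpace Topology Laplacian

theorem iteratedFDeriv_two_eq_of_hasDerivAt {E F : Type*} [NormedAddCommGroup E] [NormedSpace ℝ E]
    [NormedAddCommGroup F] [NormedSpace ℝ F] {f : E → F} {x v : E} (hf : ContDiffAt ℝ 2 f x)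
    {g : ℝ → F} {g' : F} (hg : ∀ᶠ s in 𝓝 (0 : ℝ), HasDerivAt (fun s => f (x + s • v)) (g s) s)
    (hg' : HasDerivAt g g' 0) : iteratedFDeriv ℝ 2 f x ![v, v] = g' := by
  have hline : ∀ s : ℝ, HasDerivAt (fun s : ℝ => x + s • v) v s := fun s => by
    simpa using ((hasDerivAt_id s).smul_const v).const_add x
  have hd : ∀ᶠ s in 𝓝 (0 : ℝ), DifferentiableAt ℝ f (x + s • v) := by
    have h1 : ∀ᶠ y in 𝓝 x, DifferentiableAt ℝ f y :=
      (hf.eventually (by simp)).mono fun y hy => hy.differentiableAt (by norm_num)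
    have h2 : Filter.Tendsto (fun s : ℝ => x + s • v) (𝓝 0) (𝓝 x) := by
      simpa using (hline 0).continuousAt.tendsto
    exact h2.eventually h1
  have h1 : g =ᶠ[𝓝 0] fun s => fderiv ℝ f (x + s • v) v := by
    filter_upwards [hg, hd] with s h1 h2
    exact h1.unique (h2.hasFDerivAt.comp_hasDerivAt s (hline s))
  have h2 : HasFDerivAt (fderiv ℝ f) (fderiv ℝ (fderiv ℝ f) x) (x + (0 : ℝ) • v) := by
    simpa using ((hf.fderiv_right (m := 1) (by norm_num)).differentiableAt
      (by norm_num)).hasFDerivAt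
  have h3 : HasDerivAt (fun s : ℝ => fderiv ℝ f (x + s • v)) (fderiv ℝ (fderiv ℝ f) x v) 0 :=
    h2.comp_hasDerivAt (0 : ℝ) (hline 0)
  have h4 : HasDerivAt (fun s : ℝ => fderiv ℝ f (x + s • v) v) (fderiv ℝ (fderiv ℝ f) x v v) 0 := by
    simpa using! h3.clm_apply (hasDerivAt_const (0 : ℝ) v)
  rw [iteratedFDeriv_two_apply, (hg'.congr_of_eventuallyEq h1.symm).unique h4]
  rfl

variable {E : Type*} [NormedAddCommGroup E] [InnerProductSpace ℝ E]

/-- The Kelvin transform of the power `L ^ (k + 2)` of an isotropic complex linear form. -/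
noncomputable def kelvinPower (L : E →L[ℝ] ℂ) (k : ℕ) (z : E) : ℂ :=
  ((‖z‖ ^ 2) ^ (-((Module.finrank ℝ E : ℝ) / 2 + k + 1)) : ℝ) • L z ^ (k + 2)

theorem contDiffAt_kelvinPower_sub (L : E →L[ℝ] ℂ) (k : ℕ) {a x : E} (hx : x ≠ a) :
    ContDiffAt ℝ 2 (fun z => kelvinPower L k (z - a)) x := by
  unfold kelvinPower
  have h : ‖x - a‖ ^ 2 ≠ 0 := by simpa [sub_eq_zero] using hx
  have h1 : ContDiffAt ℝ 2 (fun z : E => ‖z - a‖ ^ 2) x :=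
    ((contDiff_norm_sq ℝ).contDiffAt).comp x (contDiffAt_id.sub contDiffAt_const)
  refine (h1.rpow_const_of_ne h).smul (ContDiffAt.pow ?_ _)
  exact L.contDiff.contDiffAt.comp x (contDiffAt_id.sub contDiffAt_const)

/-- Along the line x + se the squared distance to a is N + 2cs + s² and L is affine in s, so the
formula is a second derivative in one variable, arranged by powers of L(x-a). -/
theorem iteratedFDeriv_two_kelvinPower_sub (L : E →L[ℝ] ℂ) (k : ℕ) {a x e : E} (hx : x ≠ a)
    (he : ‖e‖ = 1) {b N c : ℝ} (hb : b = (Module.finrank ℝ E : ℝ) / 2 + k + 1)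
    (hN : N = ‖x - a‖ ^ 2) (hc : c = inner ℝ (x - a) e) :
    iteratedFDeriv ℝ 2 (fun z => kelvinPower L k (z - a)) x ![e, e] =
      ((N ^ (-b) : ℝ) : ℂ) * ((k + 2) * (k + 1) * L e ^ 2 * L (x - a) ^ k)
      + ((-4 * b * (k + 2) * N ^ (-b - 1) : ℝ) : ℂ) * (c * L e) * L (x - a) ^ (k + 1)
      + ((-2 * b * N ^ (-b - 1) + 4 * b * (b + 1) * N ^ (-b - 2) * c ^ 2 : ℝ) : ℂ)
        * L (x - a) ^ (k + 2) := by
  have hN0 : 0 < N := by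
    rw [hN]; have := norm_pos_iff.2 (sub_ne_zero.2 hx); positivity
  have hfun : (fun s : ℝ => kelvinPower L k (x + s • e - a)) = fun s =>
      (((N + 2 * c * s + s ^ 2) ^ (-b) : ℝ) : ℂ) * (L (x - a) + s * L e) ^ (k + 2) := by
    ext s
    have h1 : ‖x + s • e - a‖ ^ 2 = N + 2 * c * s + s ^ 2 := by
      rw [show x + s • e - a = (x - a) + s • e by abel, norm_add_sq_real, inner_smul_right,
        norm_smul, he, hN, hc, mul_one, Real.norm_eq_abs, sq_abs]
      ring
    have h2 : L (x + s • e - a) = L (x - a) + s * L e := by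
      rw [show x + s • e - a = (x - a) + s • e by abel, map_add, map_smul, Complex.real_smul]
    rw [kelvinPower, h1, h2, ← hb, Complex.real_smul]
  have hP : ∀ s : ℝ, HasDerivAt (fun s : ℝ => N + 2 * c * s + s ^ 2) (2 * c + 2 * s) s := by
    intro s
    have := (((hasDerivAt_id s).const_mul (2 * c)).const_add N).add (hasDerivAt_pow 2 s)
    simpa using! this
  have hl : ∀ s : ℝ, HasDerivAt (fun s : ℝ => L (x - a) + s * L e) (L e) s := by
    intro s
    simpa using ((hasDerivAt_id s).ofReal_comp.mul_const (L e)).const_add (L (x - a))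
  have hpow : ∀ (r s : ℝ), 0 < N + 2 * c * s + s ^ 2 →
      HasDerivAt (fun s : ℝ => (((N + 2 * c * s + s ^ 2) ^ r : ℝ) : ℂ))
        (((2 * c + 2 * s) * r * (N + 2 * c * s + s ^ 2) ^ (r - 1) : ℝ) : ℂ) s := fun r s hs =>
    ((hP s).rpow_const (Or.inl hs.ne')).ofReal_comp
  have hlin : HasDerivAt (fun s : ℝ => ((2 * c + 2 * s : ℝ) : ℂ)) ((2 : ℝ) : ℂ) 0 := by
    simpa using (((hasDerivAt_id (0 : ℝ)).const_mul 2).const_add (2 * c)).ofReal_comp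
  have hpos : ∀ᶠ s in 𝓝 (0 : ℝ), 0 < N + 2 * c * s + s ^ 2 := by
    have : Filter.Tendsto (fun s : ℝ => N + 2 * c * s + s ^ 2) (𝓝 0) (𝓝 N) := by
      simpa using (hP 0).continuousAt.tendsto
    exact this.eventually (lt_mem_nhds hN0)
  have h0 : 0 < N + 2 * c * 0 + 0 ^ 2 := by simpa using hN0
  refine iteratedFDeriv_two_eq_of_hasDerivAt (contDiffAt_kelvinPower_sub L k hx)
    (g := fun s => ((2 * c + 2 * s : ℝ) : ℂ) * ((-b : ℝ) : ℂ) *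
        (((N + 2 * c * s + s ^ 2) ^ (-b - 1) : ℝ) : ℂ) * (L (x - a) + s * L e) ^ (k + 2) +
      (((N + 2 * c * s + s ^ 2) ^ (-b) : ℝ) : ℂ) *
        ((k + 2 : ℂ) * (L (x - a) + s * L e) ^ (k + 1) * L e)) ?_ ?_
  · rw [hfun]
    filter_upwards [hpos] with s hs
    have := (hpow (-b) s hs).mul ((hl s).fun_pow (k + 2))
    refine this.congr_deriv ?_
    push_cast
    simp
  · have h1 := (((hlin.mul_const ((-b : ℝ) : ℂ)).mul (hpow (-b - 1) 0 h0)).mul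
      ((hl 0).fun_pow (k + 2))).add ((hpow (-b) 0 h0).mul
        ((((hl 0).fun_pow (k + 1)).const_mul (k + 2 : ℂ)).mul_const (L e)))
    refine h1.congr_deriv ?_
    simp only [Pi.mul_apply, mul_zero, add_zero, ne_eq, OfNat.ofNat_ne_zero, not_false_eq_true, zero_pow,
      Complex.ofReal_zero, zero_mul, Nat.add_sub_cancel, show k + 2 - 1 = k + 1 from rfl,
      show -b - 1 - 1 = -b - 2 by ring]
    push_cast
    ring

/-- Summed over the basis, the first term vanishes by isotropy. As ∑ c_i L(e_i) = L(x-a) and ∑ c_i²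
= N, the rest is 4b(b - k - 1 - d/2) N^(-b-1) L(x-a)^(k+2), where d is the dimension, and b = d/2 +
k + 1 is the exponent that kills it. -/
theorem harmonicAt_kelvinPower_sub [FiniteDimensional ℝ E] {ι : Type*} [Fintype ι] (e : OrthonormalBasis ι ℝ E)
    (L : E →L[ℝ] ℂ) (hL : ∑ i, L (e i) ^ 2 = 0) (k : ℕ) {a x : E} (hx : x ≠ a) :
    HarmonicAt (fun z => kelvinPower L k (z - a)) x := by
  refine ⟨contDiffAt_kelvinPower_sub L k hx, ?_⟩
  filter_upwards [isOpen_ne.mem_nhds hx] with x hx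
  rw [laplacian_eq_iteratedFDeriv_orthonormalBasis _ e, Pi.zero_apply]
  set b : ℝ := (Module.finrank ℝ E : ℝ) / 2 + k + 1 with hb
  set N := ‖x - a‖ ^ 2 with hN
  have hN0 : 0 < N := by
    rw [hN]; have := norm_pos_iff.2 (sub_ne_zero.2 hx); positivity
  have hc : ∑ i, (inner ℝ (x - a) (e i) : ℝ) ^ 2 = N := by
    rw [hN, ← e.sum_sq_norm_inner_left]; simp
  have hcL : ∑ i, ((inner ℝ (x - a) (e i) : ℝ) : ℂ) * L (e i) = L (x - a) := by
    have h := congrArg L (e.sum_repr' (x - a))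
    rw [map_sum] at h
    rw [← h]
    refine Finset.sum_congr rfl fun i _ => ?_
    rw [map_smul, Complex.real_smul, real_inner_comm]
  have hcard : (Fintype.card ι : ℝ) = Module.finrank ℝ E := by
    rw [Module.finrank_eq_card_basis e.toBasis]
  simp only [iteratedFDeriv_two_kelvinPower_sub L k hx (e.norm_eq_one _) hb hN rfl]
  rw [Finset.sum_add_distrib, Finset.sum_add_distrib, ← Finset.sum_mul, ← Finset.sum_mul,
    ← Finset.mul_sum, ← Finset.mul_sum, ← Finset.sum_mul, ← Finset.mul_sum, hL, hcL,
    ← Complex.ofReal_sum, Finset.sum_add_distrib, ← Finset.mul_sum, ← Finset.mul_sum, hc, Finset.sum_const,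
    Finset.card_univ, nsmul_eq_mul, hcard]
  have hpow : N ^ (-b - 2) * N = N ^ (-b - 1) := by
    rw [← Real.rpow_add_one hN0.ne']; congr 1; ring
  rw [mul_assoc (4 * b * (b + 1)), hpow, mul_zero, zero_mul, mul_zero, zero_add, mul_assoc,
    ← pow_succ', ← add_mul, ← Complex.ofReal_add]
  have : -4 * b * (k + 2) * N ^ (-b - 1) + (-2 * b * ((Module.finrank ℝ E : ℝ) * N ^ (-b - 1)) +
      4 * b * (b + 1) * N ^ (-b - 1)) = 0 := by
    rw [hb]; ring
  rw [this]
  simp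

end Kelvin

/-! ### Test functions: decay, lower bound and norm -/

section TestFunction
open InnerProductSpace Topology
variable {n : ℕ}

/-- The isotropic linear form `z ↦ t + i x₁`. -/
noncomputable def isotropicForm (n : ℕ) : AmbientSpace n →L[ℝ] ℂ :=
  Complex.ofRealCLM.comp (EuclideanSpace.proj (Fin.last n)) +
    Complex.I • Complex.ofRealCLM.comp (EuclideanSpace.proj 0)

theorem isotropicForm_apply (z : AmbientSpace n) :
    isotropicForm n z = (z (Fin.last n) : ℂ) + Complex.I * z 0 := by
  simp [isotropicForm]

theorem sum_isotropicForm_sq (hn : 1 ≤ n) :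
    ∑ i, isotropicForm n (EuclideanSpace.basisFun (Fin (n + 1)) ℝ i) ^ 2 = 0 := by
  have hne : Fin.last n ≠ 0 := by
    rw [ne_eq, Fin.last_eq_zero_iff]; omega
  have h : ∀ i, isotropicForm n (EuclideanSpace.basisFun (Fin (n + 1)) ℝ i) ^ 2 =
      (if i = Fin.last n then 1 else 0) + (if i = 0 then -1 else 0) := by
    intro i
    rw [isotropicForm_apply]
    by_cases h1 : i = Fin.last n
    · subst h1
      simp [hne, hne.symm]
    · by_cases h2 : i = 0
      · subst h2
        simp [hne, hne.symm]
      · simp [h1, h2, Ne.symm h1, Ne.symm h2]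
  simp only [h, Finset.sum_add_distrib, Finset.sum_ite_eq', Finset.mem_univ, if_true]
  ring

theorem norm_isotropicForm_le (hn : 1 ≤ n) (z : AmbientSpace n) : ‖isotropicForm n z‖ ≤ ‖z‖ := by
  have hne : Fin.last n ≠ 0 := by
    rw [ne_eq, Fin.last_eq_zero_iff]; omega
  refine le_of_sq_le_sq ?_ (norm_nonneg _)
  rw [isotropicForm_apply, ← Complex.normSq_eq_norm_sq, Complex.normSq_apply,
    EuclideanSpace.norm_sq_eq]
  have : ∑ i ∈ {Fin.last n, 0}, ‖z i‖ ^ 2 ≤ ∑ i, ‖z i‖ ^ 2 :=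
    Finset.sum_le_sum_of_subset_of_nonneg (Finset.subset_univ _) fun _ _ _ => sq_nonneg _
  rw [Finset.sum_pair hne] at this
  simpa [pow_two] using this

/-- A harmonic function on the complement of `a` that decays like `|z - a|^{-(n + 1 + k)}`. -/
noncomputable def kelvinTest (k : ℕ) (a z : AmbientSpace n) : ℝ :=
  (kelvinPower (isotropicForm n) k (z - a)).re

theorem harmonicOnNhd_kelvinTest (hn : 1 ≤ n) (k : ℕ) {a : AmbientSpace n} (ha : height a ≤ 0) :
    HarmonicOnNhd (kelvinTest k a) (upperHalf n) := by
  intro x hx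
  have hxa : x ≠ a := by
    rintro rfl
    exact not_lt_of_ge ha hx
  exact (harmonicAt_kelvinPower_sub (EuclideanSpace.basisFun (Fin (n + 1)) ℝ) (isotropicForm n)
    (sum_isotropicForm_sq hn) k hxa).comp_CLM Complex.reCLM

theorem abs_kelvinTest_le (hn : 1 ≤ n) (k : ℕ) {a z : AmbientSpace n} (hz : z ≠ a) :
    |kelvinTest k a z| ≤ ‖z - a‖ ^ (-((n : ℝ) + 1 + k)) := by
  have hy : 0 < ‖z - a‖ := norm_pos_iff.2 (sub_ne_zero.2 hz)
  refine (Complex.abs_re_le_norm _).trans ?_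
  rw [kelvinPower, norm_smul, norm_pow, Real.norm_of_nonneg (by positivity)]
  calc _ ≤ (‖z - a‖ ^ 2) ^ (-((Module.finrank ℝ (AmbientSpace n) : ℝ) / 2 + k + 1)) *
        ‖z - a‖ ^ (k + 2) := by
        gcongr; exact norm_isotropicForm_le hn _
    _ = _ := by
        rw [finrank_euclideanSpace_fin, ← Real.rpow_natCast, ← Real.rpow_natCast,
          ← Real.rpow_mul hy.le, ← Real.rpow_add hy]
        congr 1
        push_cast
        ring

/-- Below a point `c` there are poles whose test functions do not vanish near `c`. -/
theorem exists_le_abs_kelvinTest (hn : 1 ≤ n) (k : ℕ) :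
    ∃ A c : ℝ, 1 ≤ A ∧ 0 < c ∧ ∀ (ζ z : AmbientSpace n) (η : ℝ), 0 < η →
      (∀ i, |z i - ζ i| ≤ η) →
      c * η ^ (-((n : ℝ) + 1 + k)) ≤ |kelvinTest k (verticalShift ζ (-((A + 1) * η))) z| := by
  have hcont : Filter.Tendsto (fun θ : ℝ => ((1 + Complex.I * (θ : ℂ)) ^ (k + 2)).re) (𝓝 0)
      (𝓝 1) := by
    have : Continuous fun θ : ℝ => ((1 + Complex.I * (θ : ℂ)) ^ (k + 2)).re := by fun_prop
    simpa using this.tendsto 0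
  obtain ⟨ε, hε, hε2⟩ := Metric.eventually_nhds_iff.1
    (hcont.eventually (lt_mem_nhds (by norm_num : (1 / 2 : ℝ) < 1)))
  -- From a pole this deep, points near ζ are seen within slope 1/A ≤ ε/2 of the vertical in the x₁
  -- direction, so Re (1 + iθ)^(k+2) > 1/2 there.
  set A : ℝ := max 1 (2 / ε) with hA
  have hA1 : 1 ≤ A := le_max_left _ _
  set B : ℝ := (n + 1) * (A + 2) with hB
  have hB0 : 0 < B := by positivity
  set b : ℝ := (Module.finrank ℝ (AmbientSpace n) : ℝ) / 2 + k + 1 with hb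
  have hb0 : 0 ≤ b := by positivity
  refine ⟨A, 1 / 2 * (B ^ 2) ^ (-b), hA1, by positivity, fun ζ z η hη hz => ?_⟩
  set y := z - verticalShift ζ (-((A + 1) * η)) with hy
  have hylast : y (Fin.last n) = z (Fin.last n) - ζ (Fin.last n) + (A + 1) * η := by
    simp [hy, verticalShift]
    ring
  have hyi : ∀ i, i ≠ Fin.last n → y i = z i - ζ i := fun i hi => by
    simp [hy, verticalShift, hi]
  set t := y (Fin.last n) with ht
  have htA : A * η ≤ t := by
    have := (abs_le.1 (hz (Fin.last n))).1
    rw [hylast]; linarith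
  have htB : t ≤ (A + 2) * η := by
    have := (abs_le.1 (hz (Fin.last n))).2
    rw [hylast]; linarith
  have ht0 : 0 < t := lt_of_lt_of_le (by positivity) htA
  have hnorm : ‖y‖ ≤ B * η := by
    rw [hB, mul_assoc]
    refine norm_le_of_abs_apply_le (by positivity) fun i => ?_
    by_cases hi : i = Fin.last n
    · rw [hi, abs_of_pos ht0]; exact htB
    · rw [hyi i hi]
      refine (hz i).trans ?_
      nlinarith
  have hy0 : 0 < ‖y‖ := ht0.trans_le ((le_abs_self _).trans (abs_apply_le_norm y _))
  have hre : 1 / 2 * η ^ (k + 2) ≤ (isotropicForm n y ^ (k + 2)).re := by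
    have h0 : Fin.last n ≠ 0 := by
      rw [ne_eq, Fin.last_eq_zero_iff]; omega
    have hθ : |y 0 / t| < ε := by
      rw [hyi 0 (Ne.symm h0), abs_div, abs_of_pos ht0, div_lt_iff₀ ht0]
      refine (hz 0).trans_lt ?_
      have h1 : 2 / ε ≤ A := le_max_right _ _
      rw [div_le_iff₀ hε] at h1
      nlinarith
    have h2 := hε2 (y := y 0 / t) (by rwa [Real.dist_eq, sub_zero])
    have h3 : isotropicForm n y = (t : ℂ) * (1 + Complex.I * ((y 0 / t : ℝ) : ℂ)) := by
      have : (t : ℂ) ≠ 0 := by exact_mod_cast ht0.ne'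
      rw [isotropicForm_apply, ← ht]
      push_cast
      field_simp
    rw [h3, mul_pow, ← Complex.ofReal_pow, Complex.re_ofReal_mul, mul_comm]
    have h4 : η ≤ t := by nlinarith
    exact mul_le_mul (by gcongr) h2.le (by norm_num) (by positivity)
  have hpow : (B ^ 2) ^ (-b) * (η ^ 2) ^ (-b) ≤ (‖y‖ ^ 2) ^ (-b) := by
    rw [← Real.mul_rpow (by positivity) (by positivity)]
    refine Real.rpow_le_rpow_of_nonpos (by positivity) ?_ (by linarith)
    rw [← mul_pow]
    gcongr
  have e : η ^ (-((n : ℝ) + 1 + k)) = (η ^ 2) ^ (-b) * η ^ (k + 2) := by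
    rw [hb, finrank_euclideanSpace_fin, ← Real.rpow_natCast, ← Real.rpow_natCast,
      ← Real.rpow_mul hη.le, ← Real.rpow_add hη]
    congr 1
    push_cast
    ring
  refine le_trans ?_ (le_abs_self _)
  rw [kelvinTest, kelvinPower, Complex.smul_re, smul_eq_mul, e]
  calc _ = (B ^ 2) ^ (-b) * (η ^ 2) ^ (-b) * (1 / 2 * η ^ (k + 2)) := by ring
    _ ≤ _ := by
      refine mul_le_mul hpow hre (by positivity) (by positivity)

theorem lintegral_rpow_add_norm_sub_eq (ζ : AmbientSpace n) {η : ℝ} (hη : 0 < η) (r : ℝ) :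
    ∫⁻ w, ENNReal.ofReal ((η + ‖w - ζ‖) ^ (-r)) = ENNReal.ofReal (η ^ ((n : ℝ) + 1 - r)) *
      ∫⁻ y : AmbientSpace n, ENNReal.ofReal ((1 + ‖y‖) ^ (-r)) := by
  rw [lintegral_eq_mul_lintegral_add_smul _ _ ζ hη, finrank_euclideanSpace_fin]
  have h : ∀ y : AmbientSpace n, ENNReal.ofReal ((η + ‖ζ + η • y - ζ‖) ^ (-r)) =
      ENNReal.ofReal (η ^ (-r)) * ENNReal.ofReal ((1 + ‖y‖) ^ (-r)) := fun y => by
    rw [← ENNReal.ofReal_mul (by positivity), ← Real.mul_rpow hη.le (by positivity),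
      add_sub_cancel_left, norm_smul, Real.norm_of_nonneg hη.le]
    congr 2
    ring
  simp only [h]
  rw [lintegral_const_mul' _ _ ENNReal.ofReal_ne_top, ← mul_assoc,
    ← ENNReal.ofReal_mul (by positivity), ← Real.rpow_natCast, ← Real.rpow_add hη]
  push_cast
  rfl

/-- Functions concentrated near `ζ` have cube average norm controlled by the height of `ζ`. -/
theorem exists_cubeAverageNormPow_le {q σ α M K : ℝ} (hq : 0 < q) (hσ : 0 < σ)
    (hα : 0 < (n : ℝ) + 1 + α) (hK : 0 ≤ K)
    (hM : (n : ℝ) + 1 + (n + 1 + α) * q / σ < M * q) :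
    ∃ C : ℝ≥0, ∀ (ζ : AmbientSpace n) (f : AmbientSpace n → ℝ), 0 < height ζ →
      (∀ w ∈ upperHalf n, ∀ z ∈ heightCube w,
        |f z| ≤ (K * height ζ / (height ζ + ‖w - ζ‖)) ^ M) →
      cubeAverageNormPow q σ α f ≤
        C * ENNReal.ofReal (height ζ ^ ((n : ℝ) + 1 + (n + 1 + α) * q / σ)) := by
  have hqσ : 0 < q / σ := by positivity
  set β : ℝ := (n + 1 + α) * q / σ with hβ
  set r : ℝ := M * q - β with hr
  have hfin : ∫⁻ y : AmbientSpace n, ENNReal.ofReal ((1 + ‖y‖) ^ (-r)) ≠ ∞ := by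
    refine (finite_integral_one_add_norm ?_).ne
    rw [finrank_euclideanSpace_fin]
    push_cast
    linarith
  set V := (volume : Measure (AmbientSpace n)).real (Metric.ball 0 1) with hV
  have hVt : (volume : Measure (AmbientSpace n)) (Metric.ball 0 1) ≠ ∞ := measure_ball_lt_top.ne
  have hV0 : 0 ≤ V := measureReal_nonneg
  set D : ℝ := 2 ^ |α| * (((n + 1) / 2) ^ (n + 1) * V) with hD
  have hD0 : 0 ≤ D := by positivity
  refine ⟨Real.toNNReal ((K ^ (M * σ) * D) ^ (q / σ)) *
    (∫⁻ y : AmbientSpace n, ENNReal.ofReal ((1 + ‖y‖) ^ (-r))).toNNReal, fun ζ f hη hf => ?_⟩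
  set η := height ζ with hηdef
  have hinner : ∀ w ∈ upperHalf n,
      (∫⁻ z in heightCube w, ‖f z‖ₑ ^ σ * ENNReal.ofReal (height z ^ α)) ^ (q / σ) ≤
        ENNReal.ofReal ((K ^ (M * σ) * D) ^ (q / σ) * η ^ (M * q)) *
          ENNReal.ofReal ((η + ‖w - ζ‖) ^ (-r)) := by
    intro w hw
    change 0 < height w at hw
    set s := height w with hs
    set ρ := η + ‖w - ζ‖ with hρ
    have hρ0 : 0 < ρ := by positivity
    have hsρ : s ≤ ρ := by
      have := (abs_le.1 (abs_height_sub_le_dist w ζ)).2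
      rw [dist_eq_norm] at this
      linarith
    have hpt : ∀ z ∈ heightCube w, ‖f z‖ₑ ^ σ * ENNReal.ofReal (height z ^ α) ≤
        ENNReal.ofReal ((K * η / ρ) ^ (M * σ) * (2 ^ |α| * s ^ α)) := by
      intro z hz
      rw [enorm_rpow_eq_ofReal _ hσ.le, ← ENNReal.ofReal_mul (by positivity)]
      have h1 := abs_le.1 (hz (Fin.last n))
      change -(s / 2) ≤ height z - s ∧ height z - s ≤ s / 2 at h1
      have hz0 : 0 < height z := by linarith
      have h2 : height z ^ α ≤ 2 ^ |α| * s ^ α := by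
        have := (rpow_mem_Icc_of_mem_Icc (x := height z / s) (K := 2) one_le_two
          (by rw [le_div_iff₀ hw]; linarith) (by rw [div_le_iff₀ hw]; linarith) α).2
        rwa [Real.div_rpow hz0.le hw.le, div_le_iff₀ (by positivity)] at this
      have h3 : |f z| ^ σ ≤ (K * η / ρ) ^ (M * σ) := by
        rw [Real.rpow_mul (by positivity)]
        exact Real.rpow_le_rpow (abs_nonneg _) (hf w hw z hz) hσ.le
      exact ENNReal.ofReal_le_ofReal (mul_le_mul h3 h2 (by positivity) (by positivity))
    have hvol : volume (heightCube w) ≤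
        ENNReal.ofReal (((n + 1) / 2) ^ (n + 1) * V * s ^ (n + 1)) := by
      refine (measure_mono (axisCube_subset_closedBall w hw.le)).trans_eq ?_
      rw [Measure.addHaar_closedBall _ _ (by positivity), ← ENNReal.ofReal_toReal hVt,
        finrank_euclideanSpace_fin, ← ENNReal.ofReal_mul (by positivity),
        show ((n : ℝ) + 1) * (s / 2) = (n + 1) / 2 * s by ring, mul_pow, mul_right_comm]
      rfl
    have h4 : ∫⁻ z in heightCube w, ‖f z‖ₑ ^ σ * ENNReal.ofReal (height z ^ α) ≤
        ENNReal.ofReal (K ^ (M * σ) * D * (η ^ (M * σ) * ρ ^ ((n : ℝ) + 1 + α - M * σ))) := by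
      refine (setLIntegral_mono' (isClosed_axisCube _ _).measurableSet hpt).trans ?_
      rw [setLIntegral_const]
      refine (mul_le_mul_right hvol _).trans ?_
      rw [← ENNReal.ofReal_mul (by positivity)]
      refine ENNReal.ofReal_le_ofReal ?_
      -- The weighted size of Q_w is traded for a power of ρ through s ≤ ρ; positivity of n+1+α is
      -- essential.
      have h5 : s ^ α * s ^ (n + 1) ≤ ρ ^ ((n : ℝ) + 1 + α) := by
        rw [← Real.rpow_natCast, ← Real.rpow_add hw]
        push_cast
        rw [add_comm α]
        exact Real.rpow_le_rpow hw.le hsρ hα.le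
      calc _ = K ^ (M * σ) * D * (η ^ (M * σ) * (ρ ^ (M * σ))⁻¹ * (s ^ α * s ^ (n + 1))) := by
            rw [Real.div_rpow (by positivity) hρ0.le, Real.mul_rpow hK hη.le, hD]
            ring
        _ ≤ K ^ (M * σ) * D * (η ^ (M * σ) * (ρ ^ (M * σ))⁻¹ * ρ ^ ((n : ℝ) + 1 + α)) := by
            gcongr
        _ = _ := by
            rw [sub_eq_add_neg _ (M * σ), Real.rpow_add hρ0 _ (-(M * σ)), Real.rpow_neg hρ0.le]
            ring
    refine (ENNReal.rpow_le_rpow h4 hqσ.le).trans_eq ?_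
    rw [ENNReal.ofReal_rpow_of_nonneg (by positivity) hqσ.le, ← ENNReal.ofReal_mul (by positivity),
      Real.mul_rpow (x := K ^ (M * σ) * D) (by positivity) (by positivity),
      Real.mul_rpow (x := η ^ (M * σ)) (by positivity) (by positivity),
      ← Real.rpow_mul hη.le, ← Real.rpow_mul hρ0.le,
      show M * σ * (q / σ) = M * q by field_simp,
      show ((n : ℝ) + 1 + α - M * σ) * (q / σ) = -r by rw [hr, hβ]; field_simp; ring, mul_assoc]
  calc cubeAverageNormPow q σ α f ≤
        ∫⁻ w in upperHalf n, ENNReal.ofReal ((K ^ (M * σ) * D) ^ (q / σ) * η ^ (M * q)) *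
          ENNReal.ofReal ((η + ‖w - ζ‖) ^ (-r)) :=
        setLIntegral_mono' isOpen_upperHalf.measurableSet hinner
    _ ≤ ∫⁻ w, ENNReal.ofReal ((K ^ (M * σ) * D) ^ (q / σ) * η ^ (M * q)) *
          ENNReal.ofReal ((η + ‖w - ζ‖) ^ (-r)) := setLIntegral_le_lintegral _ _
    _ = _ := by
        rw [lintegral_const_mul' _ _ ENNReal.ofReal_ne_top, lintegral_rpow_add_norm_sub_eq ζ hη,
          ENNReal.coe_mul, ENNReal.ofNNReal_toNNReal, ENNReal.coe_toNNReal hfin,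
          ENNReal.ofReal_mul (by positivity), mul_assoc, mul_assoc,
          ← mul_assoc (ENNReal.ofReal (η ^ (M * q))), ← ENNReal.ofReal_mul (by positivity),
          ← Real.rpow_add hη, mul_comm (∫⁻ y : AmbientSpace n, _)]
        congr 4
        rw [hr]; ring

end TestFunction

/-! ### The norm inequality implies the measure bound -/

section Necessity
open InnerProductSpace
variable {n : ℕ}

/-- The height of z is at least half that of w, and the pole a has height -Aη with η = `height ζ`,
so ‖z-a‖ dominates both height(w)/2 and Aη. In the path w, z, a, ζ the first leg costs n+1 and the
second 1; the last leg together with η is (A+2)η ≤ 3Aη, which costs 3. -/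
theorem height_add_norm_sub_le {A : ℝ} (hA : 1 ≤ A) {ζ w z : AmbientSpace n} (hζ : 0 < height ζ)
    (hw : w ∈ upperHalf n) (hz : z ∈ heightCube w) :
    height ζ + ‖w - ζ‖ ≤ (n + 5) * ‖z - verticalShift ζ (-((A + 1) * height ζ))‖ := by
  set η := height ζ
  set a := verticalShift ζ (-((A + 1) * η)) with ha
  change 0 < height w at hw
  have h1 := (abs_le.1 (hz (Fin.last n))).1
  change -(height w / 2) ≤ height z - height w at h1
  have h2 := (abs_le.1 (abs_height_sub_le_dist z a)).2
  rw [ha, height_verticalShift, ← ha, dist_eq_norm] at h2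
  change height z - (η + -((A + 1) * η)) ≤ _ at h2
  have h3 := dist_le_of_mem_axisCube hw.le hz
  rw [dist_comm] at h3
  have h4 : dist a ζ = (A + 1) * η := by
    have := dist_verticalShift ζ (-((A + 1) * η)) 0
    rw [show verticalShift ζ 0 = ζ by simp [verticalShift], sub_zero, abs_neg,
      abs_of_pos (by positivity)] at this
    exact this
  have h5 := dist_triangle4 w z a ζ
  rw [h4, dist_eq_norm w ζ, dist_eq_norm z a] at h5
  have hn0 : (0 : ℝ) ≤ n := n.cast_nonneg
  have h6 : (n + 1) * (height w / 2) ≤ (n + 1) * ‖z - a‖ := by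
    gcongr
    nlinarith
  nlinarith

/-- Normalized test functions attached to the points of the half space. -/
theorem exists_harmonic_test (hn : 1 ≤ n) {m : ℕ} {q : ℝ} (hq : 0 < q) {σ α : Fin m → ℝ}
    (hσ : ∀ i, 0 < σ i) (hα : ∀ i, -1 < α i) :
    ∃ (c : ℝ) (C : Fin m → ℝ≥0), 0 < c ∧ ∀ ζ : AmbientSpace n, 0 < height ζ →
      ∃ f : AmbientSpace n → ℝ, HarmonicOnNhd f (upperHalf n) ∧
        (∀ z, (∀ i, |z i - ζ i| ≤ height ζ) → c ≤ |f z|) ∧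
        ∀ i, cubeAverageNormPow q (σ i) (α i) f ≤ C i *
          ENNReal.ofReal (height ζ ^ ((n : ℝ) + 1 + (n + 1 + α i) * q / σ i)) := by
  have hpos : ∀ i, 0 < (n : ℝ) + 1 + α i := fun i => by
    have := hα i
    have : (1 : ℝ) ≤ n := by exact_mod_cast hn
    linarith
  -- The thresholds are positive, so exceeding their sum gives enough decay for all i at once, and
  -- one function serves every slot.
  obtain ⟨k, hk⟩ := exists_nat_gt ((∑ i, ((n : ℝ) + 1 + (n + 1 + α i) * q / σ i)) / q)
  rw [div_lt_iff₀ hq] at hk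
  have hki : ∀ i, (n : ℝ) + 1 + (n + 1 + α i) * q / σ i < ((n : ℝ) + 1 + k) * q := fun i => by
    have h1 : (n : ℝ) + 1 + (n + 1 + α i) * q / σ i ≤
        ∑ i, ((n : ℝ) + 1 + (n + 1 + α i) * q / σ i) :=
      Finset.single_le_sum (f := fun i => (n : ℝ) + 1 + (n + 1 + α i) * q / σ i)
        (fun j _ => by have := hpos j; have := hσ j; positivity) (Finset.mem_univ i)
    have : 0 < ((n : ℝ) + 1) * q := by positivity
    linarith
  set M : ℝ := n + 1 + k with hM
  have hM0 : 0 ≤ M := by positivity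
  obtain ⟨A, c, hA, hc, hlow⟩ := exists_le_abs_kelvinTest hn k
  choose C hC using fun i => exists_cubeAverageNormPow_le (n := n) (K := (n : ℝ) + 5) hq (hσ i)
    (hpos i) (by positivity) (hki i)
  refine ⟨c, C, hc, fun ζ hη => ?_⟩
  set η := height ζ with hηdef
  set a := verticalShift ζ (-((A + 1) * η)) with ha
  have hha : height a ≤ 0 := by
    rw [ha, height_verticalShift, ← hηdef]; nlinarith
  -- The factor η^M makes the lower bound near ζ independent of η.
  refine ⟨η ^ M • kelvinTest k a, fun x hx => (harmonicOnNhd_kelvinTest hn k hha x hx).const_smul,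
    fun z hz => ?_, fun i => hC i ζ _ hη fun w hw z hz => ?_⟩
  · have h1 := mul_le_mul_of_nonneg_left (hlow ζ z η hη hz) (by positivity : 0 ≤ η ^ M)
    rw [Pi.smul_apply, smul_eq_mul, abs_mul, abs_of_nonneg (by positivity : 0 ≤ η ^ M)]
    refine le_trans (le_of_eq ?_) h1
    rw [mul_left_comm, ← Real.rpow_add hη, hM]
    simp
  · have h1 := height_add_norm_sub_le hA hη hw hz
    have hρ : 0 < η + ‖w - ζ‖ := by positivity
    have hza : 0 < ‖z - a‖ := by
      by_contra h
      have : ‖z - a‖ = 0 := le_antisymm (not_lt.1 h) (norm_nonneg _)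
      rw [← hηdef, ← ha, this, mul_zero] at h1
      linarith
    have h2 := abs_kelvinTest_le hn k (sub_ne_zero.1 (norm_pos_iff.1 hza))
    rw [Pi.smul_apply, smul_eq_mul, abs_mul, abs_of_nonneg (by positivity : 0 ≤ η ^ M)]
    calc η ^ M * |kelvinTest k a z| ≤ η ^ M * ‖z - a‖ ^ (-M) := by gcongr
      _ = (η / ‖z - a‖) ^ M := by
          rw [Real.div_rpow hη.le hza.le, Real.rpow_neg hza.le, div_eq_mul_inv]
      _ ≤ _ := by
          refine Real.rpow_le_rpow (by positivity) ?_ hM0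
          rw [div_le_div_iff₀ hza hρ, mul_right_comm, mul_comm]
          exact mul_le_mul_of_nonneg_right h1 hη.le

variable {ζ : ℕ → AmbientSpace n} {ℓ : ℕ → ℝ}

/-- Take all f_i equal to the test function of the k-th center. The k-th term alone is at least
(c^(pm) μ(Δ_k))^(q/p), and the power p/q of the inequality gives the bound. -/
theorem IsWhitneyDecomposition.measure_le_of_multiNormPow_le (hn : 1 ≤ n)
    (hΔ : IsWhitneyDecomposition ζ ℓ) {m : ℕ} {p q : ℝ} (hp : 0 < p) (hq : 0 < q)
    {σ α : Fin m → ℝ} (hσ : ∀ i, 0 < σ i) (hα : ∀ i, -1 < α i) {μ : Measure (AmbientSpace n)}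
    {C : ℝ≥0} (h : ∀ f : Fin m → AmbientSpace n → ℝ, (∀ i, HarmonicOnNhd (f i) (upperHalf n)) →
      multiNormPow ζ ℓ p q μ f ≤ C * ∏ i, cubeAverageNormPow q (σ i) (α i) (f i)) :
    ∃ C : ℝ≥0, ∀ k, μ (axisCube (ζ k) (ℓ k)) ≤ C * ENNReal.ofReal (height (ζ k) ^
        ((m : ℝ) * (n + 1) * p / q + ∑ i, p * (n + 1 + α i) / σ i)) := by
  obtain ⟨ε, -, hcomp⟩ := hΔ.exists_comparable
  obtain ⟨c, D, hc, htest⟩ := exists_harmonic_test hn hq hσ hα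
  have hqp : 0 < q / p := by positivity
  set x : ℝ := (c ^ p) ^ m with hx
  have hx0 : 0 < x := by positivity
  refine ⟨Real.toNNReal x⁻¹ * (C * ∏ i, D i) ^ (p / q), fun k => ?_⟩
  obtain ⟨hη, -, hℓ, -⟩ := hcomp k
  obtain ⟨f, hf, hlow, hup⟩ := htest (ζ k) hη
  set η := height (ζ k)
  set e : ℝ := (m : ℝ) * (n + 1) * p / q + ∑ i, p * (n + 1 + α i) / σ i with he
  have h1 : (ENNReal.ofReal x * μ (axisCube (ζ k) (ℓ k))) ^ (q / p) ≤
      multiNormPow ζ ℓ p q μ fun _ : Fin m => f := by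
    refine le_trans ?_ (ENNReal.le_tsum k)
    refine ENNReal.rpow_le_rpow ?_ hqp.le
    rw [← setLIntegral_const]
    refine setLIntegral_mono' (isClosed_axisCube _ _).measurableSet fun z hz => ?_
    rw [Finset.prod_const, Finset.card_univ, Fintype.card_fin, hx,
      ENNReal.ofReal_pow (by positivity), enorm_rpow_eq_ofReal _ hp.le]
    gcongr
    -- The cube lies in the region of the lower bound because ℓ/2 ≤ η.
    exact hlow z fun i => (hz i).trans (by linarith)
  have h2 : (ENNReal.ofReal x * μ (axisCube (ζ k) (ℓ k))) ^ (q / p) ≤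
      ((C * ∏ i, D i : ℝ≥0) : ℝ≥0∞) * ENNReal.ofReal ((η ^ e) ^ (q / p)) := by
    refine (h1.trans (h _ fun _ => hf)).trans ?_
    refine (mul_le_mul_right (Finset.prod_le_prod' fun i _ => hup i) _).trans_eq ?_
    rw [Finset.prod_mul_distrib, ← Real.rpow_mul hη.le, he, rpow_exponent_eq_sum hp hq,
      Real.rpow_sum_of_pos hη,
      ENNReal.ofReal_prod_of_nonneg fun i _ => Real.rpow_nonneg hη.le _, ENNReal.coe_mul,
      ENNReal.ofNNReal_finsetProd, mul_assoc]
  have hpq : 0 < p / q := by positivity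
  have h3 := ENNReal.rpow_le_rpow h2 hpq.le
  have hone : q / p * (p / q) = 1 := by field_simp
  rw [← ENNReal.rpow_mul, hone, ENNReal.rpow_one, ENNReal.mul_rpow_of_nonneg _ _ hpq.le,
    ENNReal.ofReal_rpow_of_nonneg (by positivity) hpq.le, ← Real.rpow_mul (by positivity), hone,
    Real.rpow_one, ← ENNReal.coe_rpow_of_nonneg _ hpq.le] at h3
  calc μ (axisCube (ζ k) (ℓ k)) = ENNReal.ofReal x⁻¹ *
        (ENNReal.ofReal x * μ (axisCube (ζ k) (ℓ k))) := by
        rw [← mul_assoc, ← ENNReal.ofReal_mul (by positivity), inv_mul_cancel₀ hx0.ne',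
          ENNReal.ofReal_one, one_mul]
    _ ≤ _ := (mul_le_mul_right h3 _).trans_eq (by
        rw [ENNReal.coe_mul, ENNReal.ofNNReal_toNNReal, mul_assoc])

end Necessity

theorem theorem4 (n m : ℕ) (hn : 1 ≤ n) (hm : 1 ≤ m)
    (ζ : ℕ → AmbientSpace n) (ℓ : ℕ → ℝ) (hΔ : IsWhitneyDecomposition ζ ℓ)
    (p q : ℝ) (hp : 0 < p) (hq : 0 < q)
    (σ α : Fin m → ℝ) (hσ : ∀ i, 0 < σ i ∧ σ i ≤ q) (hα : ∀ i, -1 < α i)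
    (μ : Measure (AmbientSpace n)) :
    (∃ C : ℝ≥0, ∀ f : Fin m → AmbientSpace n → ℝ,
      (∀ i, InnerProductSpace.HarmonicOnNhd (f i) (upperHalf n)) →
        multiNormPow ζ ℓ p q μ f ≤ C * ∏ i, cubeAverageNormPow q (σ i) (α i) (f i)) ↔
    (∃ C : ℝ≥0, ∀ k, μ (axisCube (ζ k) (ℓ k)) ≤
      C * ENNReal.ofReal (height (ζ k) ^
        ((m : ℝ) * (n + 1) * p / q + ∑ i, p * (n + 1 + α i) / σ i))) :=
  ⟨fun ⟨_, h⟩ => hΔ.measure_le_of_multiNormPow_le hn hp hq (fun i => (hσ i).1) hα h,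
    fun ⟨_, h⟩ => hΔ.multiNormPow_le_of_measure_le hm hp hq (fun i => (hσ i).1) h⟩
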